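/- Let $n\ge 1$ and $m>0$. Write points of $\mathbb R^{1+n}$ as $x=(x^+,x_\perp,x^-)$ with $x^\pm\in\mathbb R$, $x_\perp=(x^1,\dots,x^{n-1})\in\mathbb R^{n-1}$, put $\tilde{\mathbf x}=(x_\perp,x^-)\in\mathbb R^n$, $\partial_\pm=\partial/\partial x^\pm$, and $\widetilde\Box=2\partial_+\partial_--\sum_{i=1}^{n-1}\partial_i^2$. For $k\in\{n,1+n\}$ let $\mathcal S_{\partial_-}(\mathbb R^k)=\bigcap_{j\ge 0}\partial_-^j\,\mathcal S(\mathbb R^k)$ with the subspace topology of the Schwartz space $\mathcal S(\mathbb R^k)$ of complex-valued functions, and let $\mathcal S'_{\partial_-}(\mathbb R^k)$ be its topological dual. The relaxation $u^*\in\mathcal S'_{\partial_-}(\mathbb R^{1+n})$ of $u\in\mathcal S'(\mathbb R^{1+n})$ is the restriction of $u$ to $\mathcal S_{\partial_-}(\mathbb R^{1+n})$. We say that $u$ admits the tame restriction $u_0\in\mathcal S'_{\partial_-}(\mathbb R^n)$ to $\{x^+=0\}$, and write $u|^*_{x^+=0}=u_0$, if there are an open set $\Omega\subset\mathbb R$ containing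 $0$ and a family $(w_s)_{s\in\Omega}$ in $\mathcal S'_{\partial_-}(\mathbb R^n)$ with $w_0=u_0$ such that $s\mapsto(w_s,g)$ is $C^\infty$ on $\Omega$ for every $g\in\mathcal S_{\partial_-}(\mathbb R^n)$ and $$(u^*,f\otimes g)=\int_\Omega (w_s,g)\,f(s)\,ds\qquad\text{for all } f\in C_c^\infty(\Omega),\ g\in\mathcal S_{\partial_-}(\mathbb R^n),$$ where $(f\otimes g)(x)=f(x^+)g(\tilde{\mathbf x})$. Theorem. Every solution $u\in\mathcal S'(\mathbb R^{1+n})$ of the light-cone Klein–Gordon equation $(\widetilde\Box+m^2)u=0$ admits exactly one tame restriction $u|^*_{x^+=0}\in\mathcal S'_{\partial_-}(\mathbb R^n)$. Moreover: (i) If $u\in\mathcal S'(\mathbb R^{1+n})$ satisfies $(\widetilde\Box+m^2)u=0$ and $u|^*_{x^+=0}=0$ in $\mathcal S'_{\partial_-}(\mathbb R^n)$, then $u=0$. (ii) For every $u_0\in\mathcal S'_{\partial_-}(\mathbb R^n)$ there is a unique $u\in\mathcal S'(\mathbb R^{1+n})$ with $(\widetilde\Box+m^2)u=0$ and $u|^*_{x^+=0}=u_0$.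 -/

import Mathlib

open scoped SchwartzMap LineDeriv ContDiff

noncomputable section

namespace LightCone

/-- `ℝᵏ` with its Euclidean structure. -/
abbrev Euc (k : ℕ) : Type := EuclideanSpace ℝ (Fin k)

/-- The `i`-th standard unit vector of `ℝᵏ`. -/
abbrev e {k : ℕ} (i : Fin k) : Euc k := EuclideanSpace.single i 1

/-! ### Light-cone coordinates

A point of `ℝ¹⁺ⁿ`, `n = d + 1`, is `x = (x⁺, x_⊥, x⁻)`: the coordinate with index `0` is `x⁺`, the
coordinate with the last index is `x⁻`, and the `d = n - 1` coordinates in between are `x_⊥`.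
The spatial part `(x_⊥, x⁻) ∈ ℝⁿ` is obtained by dropping the coordinate with index `0`; so `x⁻` is
again the coordinate with the last index. -/

/-- `(x⁺, x_⊥, x⁻) ↦ (x_⊥, x⁻)`. -/
def spatial (k : ℕ) : Euc (k + 1) →L[ℝ] Euc k :=
  LinearMap.toContinuousLinearMap
    { toFun := fun x => WithLp.toLp 2 (fun i => x i.succ)
      map_add' := fun _ _ => rfl
      map_smul' := fun _ _ => rfl }

@[simp]
lemma spatial_apply (k : ℕ) (x : Euc (k + 1)) (i : Fin k) : spatial k x i = x i.succ := rfl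

/-- `(x⁺, x_⊥, x⁻) ↦ x⁺`. -/
def plusCoord (k : ℕ) : Euc (k + 1) →L[ℝ] ℝ := EuclideanSpace.proj 0

@[simp]
lemma plusCoord_apply (k : ℕ) (x : Euc (k + 1)) : plusCoord k x = x 0 := rfl

lemma norm_le_plusCoord_add_spatial (k : ℕ) (x : Euc (k + 1)) :
    ‖x‖ ≤ ‖plusCoord k x‖ + ‖spatial k x‖ := by
  have h : ‖x‖ ^ 2 = ‖plusCoord k x‖ ^ 2 + ‖spatial k x‖ ^ 2 := by
    rw [EuclideanSpace.norm_sq_eq, EuclideanSpace.norm_sq_eq, Fin.sum_univ_succ]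
    rfl
  refine le_of_sq_le_sq ?_ (by positivity)
  rw [h]
  nlinarith [mul_nonneg (norm_nonneg (plusCoord k x)) (norm_nonneg (spatial k x))]

/-! ### Tensor products of Schwartz functions -/

lemma one_add_norm_pow_mul_le {k : ℕ} {V : Type*} [NormedAddCommGroup V] [NormedSpace ℝ V]
    (f : 𝓢(V, ℂ)) (L : Euc k →L[ℝ] V) (N i : ℕ) :
    ∃ C : ℝ, 0 ≤ C ∧ ∀ x, (1 + ‖L x‖) ^ N * ‖iteratedFDeriv ℝ i (f ∘ L) x‖ ≤ C := by
  refine ⟨(2 ^ N * (Finset.Iic (N, i)).sup (fun m => SchwartzMap.seminorm ℝ m.1 m.2) f) * ‖L‖ ^ i,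
    by positivity, fun x => ?_⟩
  rw [ContinuousLinearMap.iteratedFDeriv_comp_right L (f.smooth ⊤) x (by exact_mod_cast le_top)]
  have h1 := (iteratedFDeriv ℝ i f (L x)).norm_compContinuousLinearMap_le (fun _ => L)
  have h2 := SchwartzMap.one_add_le_sup_seminorm_apply (𝕜 := ℝ) (m := (N, i)) le_rfl le_rfl f (L x)
  simp only [Finset.prod_const, Finset.card_univ, Fintype.card_fin] at h1
  calc _ ≤ (1 + ‖L x‖) ^ N * (‖iteratedFDeriv ℝ i f (L x)‖ * ‖L‖ ^ i) := by gcongr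
    _ = ((1 + ‖L x‖) ^ N * ‖iteratedFDeriv ℝ i f (L x)‖) * ‖L‖ ^ i := by ring
    _ ≤ _ := by gcongr

/-- The tensor product `(f ⊗ g)(x⁺, x_⊥, x⁻) = f(x⁺) g(x_⊥, x⁻)`. -/
def tensor {k : ℕ} (f : 𝓢(ℝ, ℂ)) (g : 𝓢(Euc k, ℂ)) : 𝓢(Euc (k + 1), ℂ) where
  toFun x := f (x 0) * g (spatial k x)
  smooth' := ((f.smooth ⊤).comp (plusCoord k).contDiff).mul
    ((g.smooth ⊤).comp (spatial k).contDiff)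
  decay' := by
    intro N n
    choose A hA0 hA using fun i => one_add_norm_pow_mul_le f (plusCoord k) N i
    choose B hB0 hB using fun i => one_add_norm_pow_mul_le g (spatial k) N i
    refine ⟨∑ i ∈ Finset.range (n + 1), (n.choose i : ℝ) * (A i * B (n - i)), fun x => ?_⟩
    have hf : ContDiff ℝ ∞ (f ∘ plusCoord k) := (f.smooth ⊤).comp (plusCoord k).contDiff
    have hg : ContDiff ℝ ∞ (g ∘ spatial k) := (g.smooth ⊤).comp (spatial k).contDiff
    have hmul := norm_iteratedFDeriv_mul_le hf hg x (n := n) (by exact_mod_cast le_top)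
    have hx : ‖x‖ ^ N ≤ (1 + ‖plusCoord k x‖) ^ N * (1 + ‖spatial k x‖) ^ N := by
      rw [← mul_pow]
      refine pow_le_pow_left₀ (norm_nonneg x) ((norm_le_plusCoord_add_spatial k x).trans ?_) N
      nlinarith [mul_nonneg (norm_nonneg (plusCoord k x)) (norm_nonneg (spatial k x))]
    calc _ ≤ ‖x‖ ^ N * _ := mul_le_mul_of_nonneg_left hmul (by positivity)
      _ ≤ ((1 + ‖plusCoord k x‖) ^ N * (1 + ‖spatial k x‖) ^ N) * _ :=
          mul_le_mul_of_nonneg_right hx (by positivity)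
      _ = ∑ i ∈ Finset.range (n + 1), (n.choose i : ℝ) *
            (((1 + ‖plusCoord k x‖) ^ N * ‖iteratedFDeriv ℝ i (f ∘ plusCoord k) x‖) *
            ((1 + ‖spatial k x‖) ^ N * ‖iteratedFDeriv ℝ (n - i) (g ∘ spatial k) x‖)) := by
          rw [Finset.mul_sum]
          exact Finset.sum_congr rfl fun i _ => by ring
      _ ≤ _ := by
          refine Finset.sum_le_sum fun i _ => mul_le_mul_of_nonneg_left ?_ (by positivity)
          exact mul_le_mul (hA i x) (hB (n - i) x) (by positivity) (hA0 i)

@[simp]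
lemma tensor_apply {k : ℕ} (f : 𝓢(ℝ, ℂ)) (g : 𝓢(Euc k, ℂ)) (x : Euc (k + 1)) :
    tensor f g x = f (x 0) * g (spatial k x) := rfl

lemma lineDerivOp_last_tensor {d : ℕ} (f : 𝓢(ℝ, ℂ)) (h : 𝓢(Euc (d + 1), ℂ)) :
    ∂_{e (Fin.last (d + 1))} (tensor f h) = tensor f (∂_{e (Fin.last d)} h) := by
  ext x
  have hs : spatial (d + 1) (e (Fin.last (d + 1))) = e (Fin.last d) := by
    ext i
    simp only [spatial_apply, PiLp.single_apply, ← Fin.succ_last, Fin.succ_inj]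
  simp only [SchwartzMap.lineDerivOp_apply, tensor_apply, lineDeriv]
  rw [← deriv_const_mul_field]
  congr 1
  funext t
  simp [map_add, map_smul, hs, Fin.last_pos.ne]

/-! ### Tame test functions and tame generalized functions -/

/-- `S_{∂₋}(ℝᵏ⁺¹) = ⋂ₘ ∂₋ᵐ S(ℝᵏ⁺¹)`, where `∂₋` is the derivative in the last coordinate `x⁻`;
as a subtype it carries the subspace topology of `S(ℝᵏ⁺¹)`. -/
def tameSchwartz (k : ℕ) : Submodule ℂ 𝓢(Euc (k + 1), ℂ) :=
  ⨅ m : ℕ, LinearMap.range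
    (LineDeriv.iteratedLineDerivOpCLM ℂ 𝓢(Euc (k + 1), ℂ)
      (fun _ : Fin m => e (Fin.last k))).toLinearMap

lemma mem_tameSchwartz {k : ℕ} {g : 𝓢(Euc (k + 1), ℂ)} :
    g ∈ tameSchwartz k ↔
      ∀ m : ℕ, ∃ h : 𝓢(Euc (k + 1), ℂ), ∂^{fun _ : Fin m => e (Fin.last k)} h = g := by
  simp [tameSchwartz, Submodule.mem_iInf]

lemma tensor_mem_tameSchwartz {d : ℕ} (f : 𝓢(ℝ, ℂ)) {g : 𝓢(Euc (d + 1), ℂ)}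
    (hg : g ∈ tameSchwartz d) : tensor f g ∈ tameSchwartz (d + 1) := by
  rw [mem_tameSchwartz] at hg ⊢
  intro m
  obtain ⟨h, rfl⟩ := hg m
  refine ⟨tensor f h, ?_⟩
  clear hg
  simp only [LineDeriv.iteratedLineDerivOp_const_eq_iter_lineDerivOp]
  induction m with
  | zero => rfl
  | succ m ih =>
    rw [Function.iterate_succ_apply', Function.iterate_succ_apply', ih, lineDerivOp_last_tensor]

/-- `f ⊗ g` as an element of `S_{∂₋}(ℝ¹⁺ⁿ)`, for `f ∈ S(ℝ)` and `g ∈ S_{∂₋}(ℝⁿ)`, `n = d + 1`. -/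
def tameTensor {d : ℕ} (f : 𝓢(ℝ, ℂ)) (g : tameSchwartz d) : tameSchwartz (d + 1) :=
  ⟨tensor f g, tensor_mem_tameSchwartz f g.2⟩

/-- The space `S'_{∂₋}(ℝᵏ⁺¹)` of tame generalized functions: the (weak-*) topological dual of
`S_{∂₋}(ℝᵏ⁺¹)`. -/
abbrev TameDistribution (k : ℕ) : Type := tameSchwartz k →Lₚₜ[ℂ] ℂ

/-- The relaxation `u*` of `u ∈ S'(ℝᵏ⁺¹)`: its restriction to `S_{∂₋}(ℝᵏ⁺¹)`. -/
def relaxation {k : ℕ} (u : 𝓢'(Euc (k + 1), ℂ)) : TameDistribution k :=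
  PointwiseConvergenceCLM.precomp ℂ (tameSchwartz k).subtypeL u

lemma relaxation_apply {k : ℕ} (u : 𝓢'(Euc (k + 1), ℂ)) (g : tameSchwartz k) :
    relaxation u g = u (g : 𝓢(Euc (k + 1), ℂ)) := rfl

/-- The family `(w_s)_{s ∈ Ω}` exhibits the tame generalized function `v` on `ℝ¹⁺ⁿ` as being
`C^∞`-dependent on the parameter `x⁺ ∈ Ω` (values of `w` outside `Ω` play no role). The functions
`f` run through `D(Ω)`. -/
structure IsParameterFamily {d : ℕ} (v : TameDistribution (d + 1)) (Ω : Set ℝ)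
    (w : ℝ → TameDistribution d) : Prop where
  eq_integral : ∀ f : 𝓢(ℝ, ℂ), HasCompactSupport f → tsupport f ⊆ Ω → ∀ g : tameSchwartz d,
    v (tameTensor f g) = ∫ s in Ω, w s g * f s
  smooth : ∀ g : tameSchwartz d, ContDiffOn ℝ ∞ (fun s => w s g) Ω

/-- `u₀` is a tame restriction of `u` to `{x⁺ = 0}`: on an open neighbourhood `Ω` of `0` the
relaxation of `u` is `C^∞`-dependent on `x⁺ ∈ Ω`, and `u₀` is the value at `x⁺ = 0` of the
corresponding family. -/
def IsTameRestriction {d : ℕ} (u : 𝓢'(Euc (d + 2), ℂ)) (u₀ : TameDistribution d) : Prop :=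
  ∃ Ω : Set ℝ, IsOpen Ω ∧ (0 : ℝ) ∈ Ω ∧ ∃ w : ℝ → TameDistribution d,
    IsParameterFamily (relaxation u) Ω w ∧ w 0 = u₀

/-! ### The light-cone Klein-Gordon equation -/

/-- The light-cone d'Alembertian `2 ∂₊ ∂₋ - ∑_{i=1}^{n-1} ∂ᵢ²` on `S'(ℝ¹⁺ⁿ)`, `n = d + 1`. -/
def lcBox {d : ℕ} (u : 𝓢'(Euc (d + 2), ℂ)) : 𝓢'(Euc (d + 2), ℂ) :=
  (2 : ℂ) • ∂_{e (0 : Fin (d + 2))} (∂_{e (Fin.last (d + 1))} u)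
    - ∑ i : Fin d, ∂_{e i.castSucc.succ} (∂_{e i.castSucc.succ} u)

/-- `u` solves `(2 ∂₊ ∂₋ - ∑ ∂ᵢ² + m²) u = 0`. -/
def IsLCKGSolution {d : ℕ} (m : ℝ) (u : 𝓢'(Euc (d + 2), ℂ)) : Prop :=
  lcBox u + ((m : ℂ) ^ 2) • u = 0

end LightCone

end

open LightCone

noncomputable section

namespace LightCone

/-! ### Partial derivatives and Schwartz functions -/

/-! On the Fourier side the equation is multiplication by the real symbol p(ξ) = m² + 4π²|ξ_⊥|² −
8π²ξ⁺ξ⁻ (`kgSymbol`). Since m > 0, p has no zeros with ξ⁻ = 0, so the mass shell {p = 0} is a graph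
ξ⁺ = ξ⁺(ξ_⊥, ξ⁻) over {ξ⁻ ≠ 0}, and |ξ⁺| → ∞ as ξ⁻ → 0. A Schwartz function restricted to the shell
therefore extends by zero to a Schwartz function of (ξ_⊥, ξ⁻) divisible by every power of ξ⁻, and
such functions are exactly the Fourier transforms of S_{∂₋}(ℝⁿ). This yields a continuous map R =
`tameRestriction` from S(ℝ¹⁺ⁿ) to S_{∂₋}(ℝⁿ).

Two facts about R carry the theorem. It has a continuous linear right inverse E = `tameExtension`:
on the Fourier side, take the flat function constant in ξ⁺ and multiply it by a cutoff that is a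
function of p. And its kernel is exactly the range of the Klein-Gordon operator
(`tameRestriction_kgOp`, `exists_kgOp_eq`), because a Schwartz function vanishing on the shell is p
times a Schwartz function (`exists_eq_kgSymbol_mul`). Solutions are the functionals that kill this
range, so u ↦ u ∘ E and u₀ ↦ u₀ ∘ R are mutually inverse bijections between solutions and
S'_{∂₋}(ℝⁿ).

It remains to see that u ∘ E is the tame restriction of u. The functions f ⊗ g and ∫ f(s) (Eg)(· − s
e₀) ds have the same Fourier transform on the shell (`tameRestriction_tensor`), so u does not
distinguish them. The family w_s(g) = u((Eg)(· − s e₀)) is smooth in s, and u may be moved inside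
the integral (`integral_apply_translate`). Uniqueness of tame restrictions needs no equation: it is
the fundamental lemma of the calculus of variations together with continuity in s.

The integral of translates, the shell restriction, the shell extension and the quotient by p are all
shown to be Schwartz by one criterion, `exists_schwartz_lift`. -/

/-- The covector with components `c`. -/
def covector {k : ℕ} (c : Fin k → ℂ) : Euc k →L[ℝ] ℂ :=
  ∑ j, (EuclideanSpace.proj j : Euc k →L[ℝ] ℝ).smulRight (c j)

@[simp]
lemma covector_apply {k : ℕ} (c : Fin k → ℂ) (v : Euc k) : covector c v = ∑ j, v j • c j := by
  simp [covector]

lemma covector_eq {k : ℕ} (L : Euc k →L[ℝ] ℂ) : covector (fun j => L (e j)) = L := by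
  ext v
  rw [covector_apply]
  conv_rhs => rw [← (EuclideanSpace.basisFun (Fin k) ℝ).sum_repr v]
  simp

lemma HasFDerivAt.covector {k : ℕ} {ψ : Euc k → ℂ} {L : Euc k →L[ℝ] ℂ} {x : Euc k}
    (h : HasFDerivAt ψ L x) {c : Fin k → ℂ} (hc : ∀ j, L (e j) = c j) :
    HasFDerivAt ψ (covector c) x := by
  rwa [← funext hc, covector_eq]

lemma covector_add {k : ℕ} (c c' : Fin k → ℂ) :
    covector (fun j => c j + c' j) = covector c + covector c' := by
  ext v
  simp [Finset.sum_add_distrib]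

lemma covector_zero {k : ℕ} : covector (fun _ : Fin k => (0 : ℂ)) = 0 := by
  ext v
  simp

lemma norm_proj_le {k : ℕ} (j : Fin k) : ‖(EuclideanSpace.proj j : Euc k →L[ℝ] ℝ)‖ ≤ 1 :=
  ContinuousLinearMap.opNorm_le_bound _ zero_le_one fun x => by
    simpa using PiLp.norm_apply_le x j

lemma schwartz_hasFDerivAt {k : ℕ} (φ : 𝓢(Euc k, ℂ)) (x : Euc k) :
    HasFDerivAt φ (covector fun j => (∂_{e j} φ) x) x := by
  have h := φ.hasFDerivAt x
  rwa [← covector_eq (fderiv ℝ φ x)] at h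

lemma fderiv_eq_of_covector {k : ℕ} {ψ : Euc k → ℂ} {ψ' : Fin k → Euc k → ℂ}
    (h : ∀ x, HasFDerivAt ψ (covector fun j => ψ' j x) x) :
    fderiv ℝ ψ = ∑ j, fun x => ((ContinuousLinearMap.smulRightL ℝ (Euc k) ℂ)
      (EuclideanSpace.proj j : Euc k →L[ℝ] ℝ)) (ψ' j x) := by
  funext x
  rw [(h x).fderiv, covector, Finset.sum_apply]
  rfl

lemma contDiff_succ_of_partials {k n : ℕ} {ψ : Euc k → ℂ} {ψ' : Fin k → Euc k → ℂ}
    (h : ∀ x, HasFDerivAt ψ (covector fun j => ψ' j x) x) (h' : ∀ j, ContDiff ℝ n (ψ' j)) :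
    ContDiff ℝ (n + 1) ψ := by
  rw [contDiff_succ_iff_fderiv]
  refine ⟨fun x => (h x).differentiableAt, by simp, ?_⟩
  rw [fderiv_eq_of_covector h]
  have : (∑ j, fun x => ((ContinuousLinearMap.smulRightL ℝ (Euc k) ℂ)
      (EuclideanSpace.proj j : Euc k →L[ℝ] ℝ)) (ψ' j x)) = fun x => ∑ j,
      ((ContinuousLinearMap.smulRightL ℝ (Euc k) ℂ)
        (EuclideanSpace.proj j : Euc k →L[ℝ] ℝ)) (ψ' j x) := by
    funext x
    rw [Finset.sum_apply]
  rw [this]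
  exact ContDiff.sum fun j _ => (ContinuousLinearMap.contDiff _).comp (h' j)

/-- The differential is the sum over j of the coordinate covectors times ψ'_j, and these covectors
have norm at most 1. This reduces Schwartz seminorms to estimates of partial derivatives. -/
lemma norm_iteratedFDeriv_succ_le_sum {k n : ℕ} {ψ : Euc k → ℂ} {ψ' : Fin k → Euc k → ℂ}
    (h : ∀ x, HasFDerivAt ψ (covector fun j => ψ' j x) x) (h' : ∀ j, ContDiff ℝ n (ψ' j))
    (x : Euc k) :
    ‖iteratedFDeriv ℝ (n + 1) ψ x‖ ≤ ∑ j, ‖iteratedFDeriv ℝ n (ψ' j) x‖ := by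
  rw [← norm_iteratedFDeriv_fderiv, fderiv_eq_of_covector h, iteratedFDeriv_sum_apply]
  · refine (norm_sum_le _ _).trans (Finset.sum_le_sum fun j _ => ?_)
    refine (ContinuousLinearMap.norm_iteratedFDeriv_comp_left _ (h' j).contDiffAt le_rfl).trans ?_
    refine mul_le_of_le_one_left (norm_nonneg _) ?_
    refine ContinuousLinearMap.opNorm_le_bound _ zero_le_one fun c => ?_
    rw [one_mul]
    refine (ContinuousLinearMap.norm_smulRight_apply _ _).le.trans ?_
    exact mul_le_of_le_one_left (norm_nonneg _) (norm_proj_le j)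
  · exact fun j _ => ((ContinuousLinearMap.contDiff
      ((ContinuousLinearMap.smulRightL ℝ (Euc k) ℂ) (EuclideanSpace.proj j : Euc k →L[ℝ] ℝ))).comp
        (h' j)).contDiffAt

/-! ### A criterion for a linear map to take values in Schwartz functions -/

section Lift

variable {W : Type*} [AddCommGroup W] [Module ℂ W]
  {k : ℕ} {𝒢 : Set (W →ₗ[ℂ] (Euc k → ℂ))}

/-- The first partial derivatives of `A w` are `B w` for sums `B` of elements of `𝒢`. -/
def HasPartialsIn (𝒢 : Set (W →ₗ[ℂ] (Euc k → ℂ))) (A : W →ₗ[ℂ] (Euc k → ℂ)) : Prop :=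
  ∃ B : Fin k → (W →ₗ[ℂ] (Euc k → ℂ)), (∀ j, B j ∈ AddSubmonoid.closure 𝒢) ∧
    ∀ w x, HasFDerivAt (A w) (covector fun j => B j w x) x

/-- Product and chain rules produce sums, so differentiation can be iterated only on the additive
closure of the family. -/
lemma HasPartialsIn.closure (h : ∀ A ∈ 𝒢, HasPartialsIn 𝒢 A) :
    ∀ A ∈ AddSubmonoid.closure 𝒢, HasPartialsIn 𝒢 A := by
  intro A hA
  induction hA using AddSubmonoid.closure_induction with
  | mem A hA => exact h A hA
  | zero =>
    refine ⟨fun _ => 0, fun _ => zero_mem _, fun w x => ?_⟩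
    simp only [LinearMap.zero_apply, Pi.zero_apply, covector_zero]
    exact hasFDerivAt_const (0 : ℂ) x
  | add A A' _ _ h h' =>
    obtain ⟨B, hB, hd⟩ := h
    obtain ⟨B', hB', hd'⟩ := h'
    refine ⟨fun j => B j + B' j, fun j => add_mem (hB j) (hB' j), fun w x => ?_⟩
    simpa [covector_add] using (hd w x).add (hd' w x)

lemma contDiff_of_hasPartialsIn (h : ∀ A ∈ 𝒢, HasPartialsIn 𝒢 A) (n : ℕ) :
    ∀ A ∈ AddSubmonoid.closure 𝒢, ∀ w, ContDiff ℝ n (A w) := by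
  induction n with
  | zero =>
    intro A hA w
    obtain ⟨B, -, hd⟩ := HasPartialsIn.closure h A hA
    rw [Nat.cast_zero, contDiff_zero, continuous_iff_continuousAt]
    exact fun x => (hd w x).continuousAt
  | succ n ih =>
    intro A hA w
    obtain ⟨B, hB, hd⟩ := HasPartialsIn.closure h A hA
    exact contDiff_succ_of_partials (hd w) fun j => ih _ (hB j) w

variable [TopologicalSpace W]

/-- The functions `A w` decay rapidly, controlled by continuous seminorms of `w`. -/
def IsRapidlyBounded (A : W →ₗ[ℂ] (Euc k → ℂ)) : Prop :=
  ∀ M : ℕ, ∃ q : Seminorm ℂ W, Continuous q ∧ ∀ w x, ‖x‖ ^ M * ‖A w x‖ ≤ q w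

lemma IsRapidlyBounded.closure (h : ∀ A ∈ 𝒢, IsRapidlyBounded A) :
    ∀ A ∈ AddSubmonoid.closure 𝒢, IsRapidlyBounded A := by
  intro A hA
  induction hA using AddSubmonoid.closure_induction with
  | mem A hA => exact h A hA
  | zero => exact fun M => ⟨0, continuous_const, fun w x => by simp⟩
  | add A A' _ _ h h' =>
    intro M
    obtain ⟨q, hq, hb⟩ := h M
    obtain ⟨q', hq', hb'⟩ := h' M
    refine ⟨q + q', hq.add hq', fun w x => ?_⟩
    calc ‖x‖ ^ M * ‖(A + A') w x‖ ≤ ‖x‖ ^ M * (‖A w x‖ + ‖A' w x‖) := by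
          gcongr
          exact norm_add_le _ _
      _ = ‖x‖ ^ M * ‖A w x‖ + ‖x‖ ^ M * ‖A' w x‖ := by ring
      _ ≤ q w + q' w := add_le_add (hb w x) (hb' w x)

/-- Induction on the order of differentiation, simultaneously for all members of the closure: each
step trades one derivative for finitely many other members, so only the order-zero decay is ever
estimated. -/
lemma iteratedFDeriv_bound_of_hasPartialsIn (h : ∀ A ∈ 𝒢, HasPartialsIn 𝒢 A)
    (hb : ∀ A ∈ 𝒢, IsRapidlyBounded A) (M n : ℕ) :
    ∀ A ∈ AddSubmonoid.closure 𝒢, ∃ q : Seminorm ℂ W, Continuous q ∧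
      ∀ w x, ‖x‖ ^ M * ‖iteratedFDeriv ℝ n (A w) x‖ ≤ q w := by
  induction n with
  | zero =>
    intro A hA
    simpa using IsRapidlyBounded.closure hb A hA M
  | succ n ih =>
    intro A hA
    obtain ⟨B, hB, hd⟩ := HasPartialsIn.closure h A hA
    choose q hq hqb using fun j => ih (B j) (hB j)
    have hsum : ∀ w, (∑ j, q j) w = ∑ j, q j w := fun w => by
      induction (Finset.univ : Finset (Fin k)) using Finset.cons_induction with
      | empty => simp
      | cons a s ha ih => rw [Finset.sum_cons, Finset.sum_cons, add_apply, ih]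
    refine ⟨∑ j, q j, ?_, fun w x => ?_⟩
    · rw [funext hsum]
      exact continuous_finsetSum _ fun j _ => hq j
    · rw [hsum]
      refine (mul_le_mul_of_nonneg_left (norm_iteratedFDeriv_succ_le_sum (hd w)
        (fun j => contDiff_of_hasPartialsIn h n _ (hB j) w) x) (by positivity)).trans ?_
      rw [Finset.mul_sum]
      exact Finset.sum_le_sum fun j _ => hqb j w x

/-- A linear map into functions on `ℝᵏ` lifts to a continuous linear map into Schwartz functions
as soon as it belongs to a family which is closed under partial derivatives and whose members decay
rapidly. -/
theorem exists_schwartz_lift [IsTopologicalAddGroup W] (h : ∀ A ∈ 𝒢, HasPartialsIn 𝒢 A)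
    (hb : ∀ A ∈ 𝒢, IsRapidlyBounded A) {A : W →ₗ[ℂ] (Euc k → ℂ)} (hA : A ∈ 𝒢) :
    ∃ T : W →L[ℂ] 𝓢(Euc k, ℂ), ∀ w x, T w x = A w x := by
  have hA' := AddSubmonoid.subset_closure hA
  choose q hq hqb using fun M n => iteratedFDeriv_bound_of_hasPartialsIn h hb M n A hA'
  let T : W →ₗ[ℂ] 𝓢(Euc k, ℂ) :=
    { toFun := fun w =>
        { toFun := A w
          smooth' := contDiff_infty.2 fun n => contDiff_of_hasPartialsIn h n A hA' w
          decay' := fun M n => ⟨q M n w, hqb M n w⟩ }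
      map_add' := fun w w' => by
        ext x
        change A (w + w') x = A w x + A w' x
        rw [map_add, Pi.add_apply]
      map_smul' := fun c w => by
        ext x
        change A (c • w) x = c • A w x
        rw [map_smul, Pi.smul_apply] }
  refine ⟨⟨T, ?_⟩, fun w x => rfl⟩
  refine (schwartz_withSeminorms ℂ (Euc k) ℂ).continuous_of_continuous_comp T fun i => ?_
  refine Seminorm.continuous_of_le (hq i.1 i.2) fun w => ?_
  exact SchwartzMap.seminorm_le_bound ℂ _ _ _ (apply_nonneg _ _) (hqb i.1 i.2 w)

end Lift

/-! ### Integrals of translates of a Schwartz function -/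

lemma exists_weight_seminorm (k M : ℕ) :
    ∃ q : Seminorm ℂ 𝓢(Euc k, ℂ), Continuous q ∧
      ∀ φ x, (1 + ‖x‖) ^ M * ‖φ x‖ ≤ q φ := by
  refine ⟨(2 : NNReal) ^ M • (Finset.Iic (M, 0)).sup (schwartzSeminormFamily ℂ (Euc k) ℂ), ?_,
    fun φ x => ?_⟩
  · exact (Seminorm.continuous_finsetSup fun i _ =>
      (schwartz_withSeminorms ℂ (Euc k) ℂ).continuous_seminorm i).const_smul _
  · have h := SchwartzMap.one_add_le_sup_seminorm_apply (𝕜 := ℂ) (m := (M, 0)) (k := M) (n := 0)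
      le_rfl le_rfl φ x
    rw [norm_iteratedFDeriv_zero] at h
    exact h

lemma continuous_comp_sub_smul {k : ℕ} (φ : 𝓢(Euc k, ℂ)) {f : ℝ → ℂ} (hf : Continuous f)
    (v x : Euc k) : Continuous fun t : ℝ => f t * φ (x - t • v) :=
  hf.mul (φ.continuous.comp (by fun_prop))

/-- `φ ↦ ∫ₐᵇ f(t) φ(x - t v) dt` as a linear map. -/
def translationIntegralAux {k : ℕ} (f : ℝ → ℂ) (hf : Continuous f) (a b : ℝ) (v : Euc k) :
    𝓢(Euc k, ℂ) →ₗ[ℂ] (Euc k → ℂ) where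
  toFun φ x := ∫ t in a..b, f t * φ (x - t • v)
  map_add' φ ψ := by
    funext x
    simp only [add_apply, mul_add, Pi.add_apply]
    exact intervalIntegral.integral_add
      ((continuous_comp_sub_smul φ hf v x).intervalIntegrable _ _)
      ((continuous_comp_sub_smul ψ hf v x).intervalIntegrable _ _)
  map_smul' c φ := by
    funext x
    simp only [smul_apply, smul_eq_mul, Pi.smul_apply, RingHom.id_apply,
      mul_left_comm _ c]
    exact intervalIntegral.integral_const_mul _ _

/-- Differentiation under the integral sign, dominated by |f(t)| times the supremum of the
differential of φ. The partial derivatives fall on φ alone. -/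
lemma translationIntegralAux_hasFDerivAt {k : ℕ} {f : ℝ → ℂ} (hf : Continuous f) (a b : ℝ)
    (v : Euc k) (φ : 𝓢(Euc k, ℂ)) (x : Euc k) :
    HasFDerivAt (translationIntegralAux f hf a b v φ)
      (covector fun j => translationIntegralAux f hf a b v (∂_{e j} φ) x) x := by
  have hc : ∀ y, Continuous fun t : ℝ => f t • fderiv ℝ φ (y - t • v) := fun y =>
    hf.smul (((φ.smooth 1).continuous_fderiv (by norm_num)).comp (by fun_prop))
  have key := intervalIntegral.hasFDerivAt_integral_of_dominated_of_fderiv_le (μ := MeasureTheory.volume)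
    (a := a) (b := b) (F := fun y t => f t * φ (y - t • v))
    (F' := fun y t => f t • fderiv ℝ φ (y - t • v)) (x₀ := x) (s := Set.univ)
    (bound := fun t => ‖f t‖ * SchwartzMap.seminorm ℝ 0 1 φ) Filter.univ_mem
    (Filter.Eventually.of_forall fun y =>
      (continuous_comp_sub_smul φ hf v y).aestronglyMeasurable)
    ((continuous_comp_sub_smul φ hf v x).intervalIntegrable _ _)
    (hc x).aestronglyMeasurable
    (Filter.Eventually.of_forall fun t _ y _ => by
      rw [norm_smul]
      refine mul_le_mul_of_nonneg_left ?_ (norm_nonneg _)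
      rw [← norm_iteratedFDeriv_one]
      exact φ.norm_iteratedFDeriv_le_seminorm ℝ 1 _)
    ((hf.norm.mul continuous_const).intervalIntegrable _ _)
    (Filter.Eventually.of_forall fun t _ y _ => by
      have h1 := (φ.hasFDerivAt (y - t • v)).comp y ((hasFDerivAt_id y).sub_const (t • v))
      exact h1.const_smul (f t))
  refine HasFDerivAt.covector key fun j => ?_
  rw [ContinuousLinearMap.intervalIntegral_apply ((hc x).intervalIntegrable _ _)]
  rfl

/-- Peetre-type inequality: for |t| ≤ R the weights at x and at x − t v differ at most by the factor
1 + R|v|. -/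
lemma norm_pow_mul_translate_le {k : ℕ} {M : ℕ} {φ : 𝓢(Euc k, ℂ)} {C : ℝ}
    (hC : ∀ x, (1 + ‖x‖) ^ M * ‖φ x‖ ≤ C) {R t : ℝ} (ht : |t| ≤ R) (v x : Euc k) :
    ‖x‖ ^ M * ‖φ (x - t • v)‖ ≤ (1 + R * ‖v‖) ^ M * C := by
  have hR : 0 ≤ R := (abs_nonneg t).trans ht
  have h1 : ‖x‖ ≤ (1 + R * ‖v‖) * (1 + ‖x - t • v‖) := by
    have h2 : ‖x‖ ≤ ‖x - t • v‖ + ‖t • v‖ := by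
      simpa using norm_add_le (x - t • v) (t • v)
    have h3 : ‖t • v‖ ≤ R * ‖v‖ := by
      rw [norm_smul, Real.norm_eq_abs]
      gcongr
    nlinarith [mul_nonneg (mul_nonneg hR (norm_nonneg v)) (norm_nonneg (x - t • v))]
  calc ‖x‖ ^ M * ‖φ (x - t • v)‖
      ≤ ((1 + R * ‖v‖) * (1 + ‖x - t • v‖)) ^ M * ‖φ (x - t • v)‖ := by gcongr
    _ = (1 + R * ‖v‖) ^ M * ((1 + ‖x - t • v‖) ^ M * ‖φ (x - t • v)‖) := by
        rw [mul_pow, mul_assoc]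
    _ ≤ _ := by
      gcongr
      exact hC _

/-- Precomposing with arbitrary continuous operators D makes the family closed under partial
derivatives, since these commute with averaging over translates and are absorbed into D. -/
lemma exists_translationIntegral {k : ℕ} (f : ℝ → ℂ) (hf : Continuous f) (a b : ℝ) (v : Euc k) :
    ∃ T : 𝓢(Euc k, ℂ) →L[ℂ] 𝓢(Euc k, ℂ), ∀ φ x, T φ x = ∫ t in a..b, f t * φ (x - t • v) := by
  refine exists_schwartz_lift (A := translationIntegralAux f hf a b v)
    (𝒢 := {A | ∃ D : 𝓢(Euc k, ℂ) →L[ℂ] 𝓢(Euc k, ℂ),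
      A = (translationIntegralAux f hf a b v).comp D.toLinearMap}) ?_ ?_
    ⟨ContinuousLinearMap.id ℂ _, rfl⟩
  · rintro _ ⟨D, rfl⟩
    refine ⟨fun j => (translationIntegralAux f hf a b v).comp
      ((LineDeriv.lineDerivOpCLM ℂ 𝓢(Euc k, ℂ) (e j)).comp D).toLinearMap,
      fun j => AddSubmonoid.subset_closure ⟨_, rfl⟩, fun φ x => ?_⟩
    exact translationIntegralAux_hasFDerivAt hf a b v (D φ) x
  · rintro _ ⟨D, rfl⟩ M
    obtain ⟨q, hq, hqb⟩ := exists_weight_seminorm k M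
    obtain ⟨B, hB⟩ := isCompact_uIcc.exists_bound_of_continuousOn (s := Set.uIcc a b)
      hf.continuousOn
    have hB0 : 0 ≤ B := (norm_nonneg _).trans (hB a Set.left_mem_uIcc)
    set R := max |a| |b|
    refine ⟨(Real.toNNReal (B * (1 + R * ‖v‖) ^ M * |b - a|) : NNReal) •
      q.comp D.toLinearMap, (hq.comp D.continuous).const_smul _, fun φ x => ?_⟩
    rw [smul_apply, NNReal.smul_def, Real.coe_toNNReal _ (by positivity)]
    change ‖x‖ ^ M * ‖∫ t in a..b, f t * D φ (x - t • v)‖ ≤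
      (B * (1 + R * ‖v‖) ^ M * |b - a|) * q (D φ)
    rw [← norm_norm x, ← norm_pow, ← norm_smul, ← intervalIntegral.integral_smul]
    refine (intervalIntegral.norm_integral_le_of_norm_le_const
      (C := B * ((1 + R * ‖v‖) ^ M * q (D φ))) fun t ht => ?_).trans_eq (by ring)
    have ht' := Set.uIoc_subset_uIcc ht
    rw [norm_smul, norm_pow, norm_norm, norm_mul, mul_left_comm]
    refine mul_le_mul (hB t ht') (norm_pow_mul_translate_le (hqb (D φ)) ?_ v x) (by positivity) hB0
    rcases Set.mem_uIcc.mp ht' with h | h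
    · exact abs_le_max_abs_abs h.1 h.2
    · exact (abs_le_max_abs_abs h.1 h.2).trans_eq (max_comm _ _)

/-- `φ ↦ ∫ₐᵇ f(t) φ(· - t v) dt` as a continuous linear map of Schwartz functions. -/
def translationIntegral {k : ℕ} (f : ℝ → ℂ) (hf : Continuous f) (a b : ℝ) (v : Euc k) :
    𝓢(Euc k, ℂ) →L[ℂ] 𝓢(Euc k, ℂ) :=
  (exists_translationIntegral f hf a b v).choose

lemma translationIntegral_apply {k : ℕ} (f : ℝ → ℂ) (hf : Continuous f) (a b : ℝ) (v : Euc k)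
    (φ : 𝓢(Euc k, ℂ)) (x : Euc k) :
    translationIntegral f hf a b v φ x = ∫ t in a..b, f t * φ (x - t • v) :=
  (exists_translationIntegral f hf a b v).choose_spec φ x

lemma lineDerivOp_eq_of_hasFDerivAt {k : ℕ} {φ : 𝓢(Euc k, ℂ)} {x : Euc k} {c : Fin k → ℂ}
    (h : HasFDerivAt φ (covector c) x) (j : Fin k) : (∂_{e j} φ) x = c j := by
  rw [SchwartzMap.lineDerivOp_apply_eq_fderiv, h.fderiv]
  simp [PiLp.single_apply]

lemma lineDerivOp_translationIntegral {k : ℕ} (f : ℝ → ℂ) (hf : Continuous f) (a b : ℝ)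
    (v : Euc k) (φ : 𝓢(Euc k, ℂ)) (j : Fin k) :
    ∂_{e j} (translationIntegral f hf a b v φ) = translationIntegral f hf a b v (∂_{e j} φ) := by
  ext x
  rw [translationIntegral_apply]
  refine lineDerivOp_eq_of_hasFDerivAt
    (c := fun j => translationIntegralAux f hf a b v (∂_{e j} φ) x) ?_ j
  have : ⇑(translationIntegral f hf a b v φ) = translationIntegralAux f hf a b v φ :=
    funext (translationIntegral_apply f hf a b v φ)
  rw [this]
  exact translationIntegralAux_hasFDerivAt hf a b v φ x

/-- The error of the approximation `∫_s^{s+h} f(t) φ(· - t v) dt ≈ h f(s) φ(· - s v)`. -/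
def translationError {k : ℕ} (f : ℝ → ℂ) (hf : Continuous f) (v : Euc k) (s h : ℝ) :
    𝓢(Euc k, ℂ) →L[ℂ] 𝓢(Euc k, ℂ) :=
  translationIntegral f hf s (s + h) v - ((h : ℂ) * f s) • SchwartzMap.compSubConstCLM ℂ (s • v)

lemma translationError_apply {k : ℕ} (f : ℝ → ℂ) (hf : Continuous f) (v : Euc k) (s h : ℝ)
    (φ : 𝓢(Euc k, ℂ)) (x : Euc k) : translationError f hf v s h φ x =
      ∫ t in s..(s + h), (f t * φ (x - t • v) - f s * φ (x - s • v)) := by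
  rw [intervalIntegral.integral_sub
    ((continuous_comp_sub_smul φ hf v x).intervalIntegrable _ _) (by simp),
    intervalIntegral.integral_const, ← translationIntegral_apply f hf]
  simp [translationError, mul_assoc]

lemma lineDerivOp_translationError {k : ℕ} (f : ℝ → ℂ) (hf : Continuous f) (v : Euc k) (s h : ℝ)
    (φ : 𝓢(Euc k, ℂ)) (j : Fin k) :
    ∂_{e j} (translationError f hf v s h φ) = translationError f hf v s h (∂_{e j} φ) := by
  have : ∂_{e j} (SchwartzMap.compSubConstCLM ℂ (s • v) φ) =
      SchwartzMap.compSubConstCLM ℂ (s • v) (∂_{e j} φ) := by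
    ext x
    have h1 := (schwartz_hasFDerivAt φ (x - s • v)).comp x ((hasFDerivAt_id x).sub_const (s • v))
    rw [ContinuousLinearMap.comp_id] at h1
    exact lineDerivOp_eq_of_hasFDerivAt (φ := SchwartzMap.compSubConstCLM ℂ (s • v) φ) h1 j
  rw [translationError, sub_apply, smul_apply,
    ← LineDeriv.lineDerivOpCLM_apply (R := ℂ) (e j) (_ - _), map_sub, map_smul,
    LineDeriv.lineDerivOpCLM_apply, LineDeriv.lineDerivOpCLM_apply, this,
    lineDerivOp_translationIntegral]
  rfl

lemma hasDerivAt_mul_comp_sub_smul {k : ℕ} (φ : 𝓢(Euc k, ℂ)) {f : ℝ → ℂ} (hf : ContDiff ℝ 1 f)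
    (v x : Euc k) (t : ℝ) : HasDerivAt (fun t : ℝ => f t * φ (x - t • v))
      (deriv f t * φ (x - t • v) - f t * (∂_{v} φ) (x - t • v)) t := by
  have h1 : HasDerivAt (fun t : ℝ => x - t • v) (-v) t := by
    simpa using ((hasDerivAt_id t).smul_const v).const_sub x
  have h2 := (φ.hasFDerivAt (x - t • v)).comp_hasDerivAt t h1
  have h3 := ((hf.differentiable (by norm_num)) t).hasDerivAt.mul h2
  refine h3.congr_deriv ?_
  rw [SchwartzMap.lineDerivOp_apply_eq_fderiv, map_neg, mul_neg, ← sub_eq_add_neg]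
  rfl

lemma exists_translate_bound {k : ℕ} (v : Euc k) (s : ℝ) (M : ℕ) (φ : 𝓢(Euc k, ℂ)) :
    ∃ P, 0 ≤ P ∧ ∀ t ∈ Set.Icc (s - 1) (s + 1), ∀ x, ‖x‖ ^ M * ‖φ (x - t • v)‖ ≤ P := by
  obtain ⟨q, -, hq⟩ := exists_weight_seminorm k M
  refine ⟨(1 + (|s| + 1) * ‖v‖) ^ M * q φ, by positivity, fun t ht x =>
    norm_pow_mul_translate_le (hq φ) ?_ v x⟩
  rw [abs_le]
  constructor <;> linarith [ht.1, ht.2, neg_abs_le s, le_abs_self s]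

lemma exists_deriv_translate_bound {k : ℕ} {f : ℝ → ℂ} (hf : ContDiff ℝ 1 f) (v : Euc k) (s : ℝ)
    (M : ℕ) (φ : 𝓢(Euc k, ℂ)) : ∃ C, 0 ≤ C ∧ ∀ t ∈ Set.Icc (s - 1) (s + 1), ∀ x,
      ‖x‖ ^ M * ‖deriv f t * φ (x - t • v) - f t * (∂_{v} φ) (x - t • v)‖ ≤ C := by
  have hK : IsCompact (Set.Icc (s - 1) (s + 1)) := isCompact_Icc
  obtain ⟨B₀, hB₀⟩ := hK.exists_bound_of_continuousOn hf.continuous.continuousOn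
  obtain ⟨B₁, hB₁⟩ := hK.exists_bound_of_continuousOn (hf.continuous_deriv le_rfl).continuousOn
  obtain ⟨P, hP0, hP⟩ := exists_translate_bound v s M φ
  obtain ⟨Q, hQ0, hQ⟩ := exists_translate_bound v s M (∂_{v} φ)
  have hs : s ∈ Set.Icc (s - 1) (s + 1) := by constructor <;> linarith
  have hB₀' : 0 ≤ B₀ := (norm_nonneg _).trans (hB₀ s hs)
  have hB₁' : 0 ≤ B₁ := (norm_nonneg _).trans (hB₁ s hs)
  refine ⟨B₁ * P + B₀ * Q, by positivity, fun t ht x => ?_⟩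
  have h1 : ‖deriv f t * φ (x - t • v) - f t * (∂_{v} φ) (x - t • v)‖ ≤
      ‖deriv f t‖ * ‖φ (x - t • v)‖ + ‖f t‖ * ‖(∂_{v} φ) (x - t • v)‖ := by
    refine (norm_sub_le _ _).trans_eq ?_
    rw [norm_mul, norm_mul]
  refine (mul_le_mul_of_nonneg_left h1 (by positivity)).trans ?_
  rw [mul_add, mul_left_comm, mul_left_comm _ ‖f t‖]
  exact add_le_add (mul_le_mul (hB₁ t ht) (hP t ht x) (by positivity) hB₁')
    (mul_le_mul (hB₀ t ht) (hQ t ht x) (by positivity) hB₀')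

/-- By the mean value inequality the weighted integrand is at most C|t − s| ≤ C|h|, and the interval
has length |h|. The restriction |h| ≤ 1 keeps t in a fixed compact interval, so C does not depend on
h. -/
lemma exists_translationError_bound {k : ℕ} {f : ℝ → ℂ} (hf : ContDiff ℝ 1 f) (v : Euc k) (s : ℝ)
    (M : ℕ) (φ : 𝓢(Euc k, ℂ)) : ∃ C, 0 ≤ C ∧ ∀ h : ℝ, |h| ≤ 1 → ∀ x,
      ‖x‖ ^ M * ‖translationError f hf.continuous v s h φ x‖ ≤ C * h ^ 2 := by
  obtain ⟨C, hC, hder⟩ := exists_deriv_translate_bound hf v s M φ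
  have hs : s ∈ Set.Icc (s - 1) (s + 1) := by constructor <;> linarith
  refine ⟨C, hC, fun h hh x => ?_⟩
  rw [translationError_apply, ← norm_norm x, ← norm_pow, ← norm_smul,
    ← intervalIntegral.integral_smul]
  have hint : ∀ t ∈ Set.uIoc s (s + h),
      ‖‖x‖ ^ M • (f t * φ (x - t • v) - f s * φ (x - s • v))‖ ≤ C * |h| := by
    intro t ht
    have ht1 : |t - s| ≤ |h| := by
      have := Set.abs_sub_left_of_mem_uIcc (Set.uIoc_subset_uIcc ht)
      simpa using this
    have ht2 : t ∈ Set.Icc (s - 1) (s + 1) := by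
      have := abs_le.1 (ht1.trans hh)
      constructor <;> linarith [this.1, this.2]
    have := (convex_Icc (s - 1) (s + 1)).norm_image_sub_le_of_norm_hasDerivWithin_le
      (fun t _ => ((hasDerivAt_mul_comp_sub_smul φ hf v x t).const_smul
        (‖x‖ ^ M)).hasDerivWithinAt)
      (fun t ht => by
        rw [norm_smul, norm_pow, norm_norm]
        exact hder t ht x) hs ht2
    rw [smul_sub]
    refine this.trans ?_
    rw [Real.norm_eq_abs]
    gcongr
  refine (intervalIntegral.norm_integral_le_of_norm_le_const hint).trans_eq ?_
  rw [add_sub_cancel_left, mul_assoc, abs_mul_abs_self, sq]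

/-- The error operator commutes with partial derivatives, so an induction on n over all φ reduces
every seminorm to the pointwise bound. -/
lemma exists_seminorm_translationError_bound {k : ℕ} {f : ℝ → ℂ} (hf : ContDiff ℝ 1 f) (v : Euc k)
    (s : ℝ) (M n : ℕ) (φ : 𝓢(Euc k, ℂ)) : ∃ C, 0 ≤ C ∧ ∀ h : ℝ, |h| ≤ 1 →
      SchwartzMap.seminorm ℂ M n (translationError f hf.continuous v s h φ) ≤ C * h ^ 2 := by
  induction n generalizing φ with
  | zero =>
    obtain ⟨C, hC, hb⟩ := exists_translationError_bound hf v s M φ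
    refine ⟨C, hC, fun h hh => SchwartzMap.seminorm_le_bound ℂ _ _ _ (by positivity) fun x => ?_⟩
    rw [norm_iteratedFDeriv_zero]
    exact hb h hh x
  | succ n ih =>
    choose C hC hb using fun j : Fin k => ih (∂_{e j} φ)
    refine ⟨∑ j, C j, Finset.sum_nonneg fun j _ => hC j, fun h hh =>
      SchwartzMap.seminorm_le_bound ℂ _ _ _
        (mul_nonneg (Finset.sum_nonneg fun j _ => hC j) (sq_nonneg h)) fun x => ?_⟩
    have h1 := norm_iteratedFDeriv_succ_le_sum (n := n)
      (schwartz_hasFDerivAt (translationError f hf.continuous v s h φ))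
      (fun j => (∂_{e j} (translationError f hf.continuous v s h φ)).smooth n) x
    refine (mul_le_mul_of_nonneg_left h1 (by positivity)).trans ?_
    rw [Finset.mul_sum, Finset.sum_mul]
    refine Finset.sum_le_sum fun j _ => ?_
    rw [lineDerivOp_translationError]
    exact (SchwartzMap.le_seminorm ℂ M n _ x).trans (hb j h hh)

lemma isBigO_translationError {k : ℕ} {f : ℝ → ℂ} (hf : ContDiff ℝ 1 f) (v : Euc k)
    (s : ℝ) (φ : 𝓢(Euc k, ℂ)) (u : 𝓢(Euc k, ℂ) →L[ℂ] ℂ) :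
    (fun h => u (translationError f hf.continuous v s h φ)) =O[nhds 0] fun h : ℝ => h ^ 2 := by
  have hu : Continuous ((normSeminorm ℂ ℂ).comp u.toLinearMap) := u.continuous.norm
  obtain ⟨I, c, -, hc⟩ := Seminorm.bound_of_continuous (schwartz_withSeminorms ℂ (Euc k) ℂ) _ hu
  choose C hC hb using fun i : ℕ × ℕ => exists_seminorm_translationError_bound hf v s i.1 i.2 φ
  refine Asymptotics.IsBigO.of_bound (c * ∑ i ∈ I, C i) ?_
  filter_upwards [Metric.ball_mem_nhds (0 : ℝ) one_pos] with h hh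
  have hh' : |h| ≤ 1 := by simpa using (Metric.mem_ball.1 hh).le
  refine (hc _).trans ?_
  rw [smul_apply, NNReal.smul_def, smul_eq_mul, mul_assoc, Real.norm_of_nonneg (sq_nonneg h)]
  refine mul_le_mul_of_nonneg_left (Seminorm.finset_sup_apply_le
    (mul_nonneg (Finset.sum_nonneg fun i _ => hC i) (sq_nonneg h)) fun i hi => ?_) c.2
  refine (hb i h hh').trans (mul_le_mul_of_nonneg_right ?_ (sq_nonneg h))
  exact Finset.single_le_sum (fun i _ => hC i) hi

lemma translationIntegral_add {k : ℕ} (f : ℝ → ℂ) (hf : Continuous f) (a b c : ℝ) (v : Euc k)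
    (φ : 𝓢(Euc k, ℂ)) : translationIntegral f hf a c v φ =
      translationIntegral f hf a b v φ + translationIntegral f hf b c v φ := by
  ext x
  rw [add_apply, translationIntegral_apply, translationIntegral_apply,
    translationIntegral_apply, intervalIntegral.integral_add_adjacent_intervals] <;>
  exact (continuous_comp_sub_smul φ hf v x).intervalIntegrable _ _

/-- Under a continuous functional, `s ↦ ∫ₐˢ f(t) φ(· - t v) dt` has derivative
`f(s) φ(· - s v)`. -/
theorem hasDerivAt_translationIntegral {k : ℕ} {f : ℝ → ℂ} (hf : ContDiff ℝ 1 f) (v : Euc k)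
    (a s : ℝ) (φ : 𝓢(Euc k, ℂ)) (u : 𝓢(Euc k, ℂ) →L[ℂ] ℂ) :
    HasDerivAt (fun s => u (translationIntegral f hf.continuous a s v φ))
      (f s * u (SchwartzMap.compSubConstCLM ℂ (s • v) φ)) s := by
  rw [hasDerivAt_iff_isLittleO_nhds_zero]
  have h2 : (fun h : ℝ => h ^ 2) =o[nhds 0] fun h : ℝ => h := by
    simpa using Asymptotics.isLittleO_pow_id (𝕜 := ℝ) one_lt_two
  refine ((isBigO_translationError hf v s φ u).trans_isLittleO h2).congr_left fun h => ?_
  rw [translationIntegral_add f hf.continuous a s (s + h)]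
  simp [translationError, mul_assoc]

/-- Both sides have the same derivative in the upper limit and vanish at a, so u passes through the
integral without any integration in Schwartz space. -/
theorem integral_apply_translate {k : ℕ} {f : ℝ → ℂ} (hf : ContDiff ℝ 1 f) (v : Euc k)
    (a b : ℝ) (φ : 𝓢(Euc k, ℂ)) (u : 𝓢(Euc k, ℂ) →L[ℂ] ℂ)
    (hu : Continuous fun s : ℝ => u (SchwartzMap.compSubConstCLM ℂ (s • v) φ)) :
    ∫ s in a..b, f s * u (SchwartzMap.compSubConstCLM ℂ (s • v) φ) =
      u (translationIntegral f hf.continuous a b v φ) := by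
  rw [intervalIntegral.integral_eq_sub_of_hasDerivAt
    (fun s _ => hasDerivAt_translationIntegral hf v a s φ u)
    ((hf.continuous.mul hu).intervalIntegrable _ _)]
  have : translationIntegral f hf.continuous a a v φ = 0 := by
    ext x
    rw [translationIntegral_apply, intervalIntegral.integral_same]
    rfl
  rw [this, map_zero, sub_zero]

/-- Since φ − φ(· − s v) = ∫₀ˢ (∂_v φ)(· − t v) dt, this is the previous derivative formula with f =
1, applied to ∂_v φ. -/
lemma hasDerivAt_apply_translate {k : ℕ} (v : Euc k) (s : ℝ) (φ : 𝓢(Euc k, ℂ))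
    (u : 𝓢(Euc k, ℂ) →L[ℂ] ℂ) :
    HasDerivAt (fun s : ℝ => u (SchwartzMap.compSubConstCLM ℂ (s • v) φ))
      (-u (SchwartzMap.compSubConstCLM ℂ (s • v) (∂_{v} φ))) s := by
  have h1 : ContDiff ℝ 1 fun _ : ℝ => (1 : ℂ) := contDiff_const
  have h2 := ((hasDerivAt_translationIntegral h1 v 0 s (∂_{v} φ) u).neg).const_add (u φ)
  rw [one_mul] at h2
  refine h2.congr_of_eventuallyEq (Filter.Eventually.of_forall fun s => ?_)
  change u _ = u φ + -u _
  rw [← sub_eq_add_neg, ← map_sub]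
  congr 1
  ext x
  rw [sub_apply, translationIntegral_apply]
  have h3 := intervalIntegral.integral_eq_sub_of_hasDerivAt (a := 0) (b := s)
    (fun t _ => hasDerivAt_mul_comp_sub_smul φ h1 v x t)
    (by
      simp only [deriv_const, zero_mul, one_mul, zero_sub]
      have := (continuous_comp_sub_smul (∂_{v} φ) continuous_one v x).neg
      simp only [Pi.one_apply, one_mul] at this
      exact this.intervalIntegrable _ _)
  simp only [deriv_const, zero_mul, one_mul, zero_sub, intervalIntegral.integral_neg, zero_smul,
    sub_zero] at h3
  simp only [one_mul, SchwartzMap.compSubConstCLM_apply]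
  linear_combination -h3

theorem contDiff_apply_translate {k : ℕ} (v : Euc k) (φ : 𝓢(Euc k, ℂ))
    (u : 𝓢(Euc k, ℂ) →L[ℂ] ℂ) :
    ContDiff ℝ ∞ fun s : ℝ => u (SchwartzMap.compSubConstCLM ℂ (s • v) φ) := by
  refine contDiff_infty.2 fun n => ?_
  induction n generalizing φ with
  | zero =>
    rw [Nat.cast_zero, contDiff_zero, continuous_iff_continuousAt]
    exact fun s => (hasDerivAt_apply_translate v s φ u).continuousAt
  | succ n ih =>
    rw [Nat.cast_succ, contDiff_succ_iff_deriv]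
    refine ⟨fun s => (hasDerivAt_apply_translate v s φ u).differentiableAt, by simp, ?_⟩
    rw [funext fun s => (hasDerivAt_apply_translate v s φ u).deriv]
    exact (ih (∂_{v} φ)).neg

/-! ### Fourier transforms of tensor products and of integrals of translates -/

open MeasureTheory FourierTransform

lemma integral_euc_succ {k : ℕ} (F : Euc (k + 1) → ℂ) :
    ∫ x, F x = ∫ y : ℝ × Euc k, F (WithLp.toLp 2 (Fin.cons y.1 y.2.ofLp : Fin (k + 1) → ℝ)) := by
  have h1 := (PiLp.volume_preserving_toLp (Fin (k + 1))).integral_comp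
    (MeasurableEquiv.toLp 2 (Fin (k + 1) → ℝ)).measurableEmbedding F
  have h2 := (volume_preserving_piFinSuccAbove (fun _ : Fin (k + 1) => ℝ) 0).symm.integral_comp
    (MeasurableEquiv.measurableEmbedding _) fun z => F (WithLp.toLp 2 z)
  have h3 := ((MeasurePreserving.id (volume : Measure ℝ)).prod
    (PiLp.volume_preserving_ofLp (Fin k))).integral_comp
    (MeasurableEquiv.prodCongr (MeasurableEquiv.refl ℝ)
      (MeasurableEquiv.toLp 2 (Fin k → ℝ)).symm).measurableEmbedding
    fun y => F (WithLp.toLp 2 (Fin.cons y.1 y.2 : Fin (k + 1) → ℝ))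
  rw [← h1, ← h2]
  refine Eq.trans ?_ h3.symm
  refine integral_congr_ae (Filter.Eventually.of_forall fun y => ?_)
  simp [MeasurableEquiv.piFinSuccAbove, Fin.insertNthEquiv]

theorem fourier_tensor {k : ℕ} (f : 𝓢(ℝ, ℂ)) (g : 𝓢(Euc k, ℂ)) (ξ : Euc (k + 1)) :
    𝓕 (tensor f g) ξ = 𝓕 f (ξ 0) * 𝓕 g (spatial k ξ) := by
  rw [SchwartzMap.fourier_coe, SchwartzMap.fourier_coe, SchwartzMap.fourier_coe,
    Real.fourier_eq', Real.fourier_eq', Real.fourier_eq', integral_euc_succ,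
    ← integral_prod_mul (μ := (volume : Measure ℝ)) (ν := (volume : Measure (Euc k)))]
  refine integral_congr_ae (Filter.Eventually.of_forall fun y => ?_)
  have hs : spatial k (WithLp.toLp 2 (Fin.cons y.1 y.2.ofLp : Fin (k + 1) → ℝ)) = y.2 := by
    ext i
    simp
  have hi : inner ℝ (WithLp.toLp 2 (Fin.cons y.1 y.2.ofLp : Fin (k + 1) → ℝ)) ξ =
      inner ℝ y.1 (ξ 0) + inner ℝ y.2 (spatial k ξ) := by
    simp only [PiLp.inner_apply, Fin.sum_univ_succ, Fin.cons_zero, Fin.cons_succ, spatial_apply]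
  simp only [tensor_apply, hs, hi, Fin.cons_zero, smul_eq_mul]
  rw [mul_add, Complex.ofReal_add, add_mul, Complex.exp_add]
  ring

/-- Fubini, then translation becomes a phase. If the support of f lies in (a, b], the first factor
is the one-dimensional Fourier transform of f at ⟨v, ξ⟩. -/
theorem fourier_translationIntegral {k : ℕ} (f : ℝ → ℂ) (hf : Continuous f) (a b : ℝ) (v : Euc k)
    (φ : 𝓢(Euc k, ℂ)) (ξ : Euc k) : 𝓕 (translationIntegral f hf a b v φ) ξ =
      (∫ t in a..b, Complex.exp (↑(-2 * Real.pi * (t * inner ℝ v ξ)) * Complex.I) * f t) *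
        𝓕 φ ξ := by
  rw [SchwartzMap.fourier_coe, SchwartzMap.fourier_coe, Real.fourier_eq', Real.fourier_eq']
  have h1 : ∀ x, Complex.exp (↑(-2 * Real.pi * inner ℝ x ξ) * Complex.I) •
      translationIntegral f hf a b v φ x = ∫ t in a..b,
        Complex.exp (↑(-2 * Real.pi * inner ℝ x ξ) * Complex.I) * (f t * φ (x - t • v)) := by
    intro x
    rw [translationIntegral_apply, smul_eq_mul, intervalIntegral.integral_const_mul]
  simp_rw [h1]
  have hcont : Continuous (Function.uncurry fun (t : ℝ) (x : Euc k) =>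
      Complex.exp (↑(-2 * Real.pi * inner ℝ x ξ) * Complex.I) * (f t * φ (x - t • v))) := by
    have h2 : Continuous fun y : ℝ × Euc k => φ (y.2 - y.1 • v) := φ.continuous.comp (by fun_prop)
    have h3 : Continuous fun y : ℝ × Euc k => (inner ℝ y.2 ξ : ℝ) := by fun_prop
    simp only [Function.uncurry_def]
    fun_prop
  have hnorm : ∀ (x : Euc k) (t : ℝ),
      ‖Complex.exp (↑(-2 * Real.pi * inner ℝ x ξ) * Complex.I) * (f t * φ (x - t • v))‖ =
        ‖f t‖ * ‖φ (x - t • v)‖ := by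
    intro x t
    rw [norm_mul, Complex.norm_exp_ofReal_mul_I, one_mul, norm_mul]
  have hint : Integrable (Function.uncurry fun (t : ℝ) (x : Euc k) =>
      Complex.exp (↑(-2 * Real.pi * inner ℝ x ξ) * Complex.I) * (f t * φ (x - t • v)))
      ((volume.restrict (Set.uIoc a b)).prod volume) := by
    rw [integrable_prod_iff hcont.aestronglyMeasurable]
    constructor
    · refine Filter.Eventually.of_forall fun t => ?_
      refine (((φ.integrable (μ := volume)).comp_sub_right (t • v)).norm.const_mul ‖f t‖).mono'
        (hcont.comp (by fun_prop : Continuous fun x : Euc k => (t, x))).aestronglyMeasurable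
        (Filter.Eventually.of_forall fun x => (hnorm x t).le)
    · simp only [Function.uncurry_apply_pair, hnorm, integral_const_mul,
        integral_sub_right_eq_self (fun x => ‖φ x‖)]
      exact ((hf.norm.mul continuous_const).intervalIntegrable a b).def'
  rw [← intervalIntegral_integral_swap hint, ← intervalIntegral.integral_mul_const]
  refine intervalIntegral.integral_congr fun t _ => ?_
  rw [← integral_sub_right_eq_self (fun x => Complex.exp (↑(-2 * Real.pi * inner ℝ x ξ) *
    Complex.I) • φ x) (t • v), ← integral_const_mul]
  refine integral_congr_ae (Filter.Eventually.of_forall fun x => ?_)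
  simp only [smul_eq_mul]
  have : Complex.exp (↑(-2 * Real.pi * inner ℝ x ξ) * Complex.I) =
      Complex.exp (↑(-2 * Real.pi * (t * inner ℝ v ξ)) * Complex.I) *
        Complex.exp (↑(-2 * Real.pi * inner ℝ (x - t • v) ξ) * Complex.I) := by
    rw [← Complex.exp_add, ← add_mul, ← Complex.ofReal_add, inner_sub_left,
      real_inner_smul_left]
    ring_nf
  rw [this]
  ring

/-! ### The mass shell -/

/-- `(x_⊥, x⁻) ↦ x_⊥`. -/
def perp (d : ℕ) : Euc (d + 1) →L[ℝ] Euc d :=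
  LinearMap.toContinuousLinearMap
    { toFun := fun x => WithLp.toLp 2 (fun i => x i.castSucc)
      map_add' := fun _ _ => rfl
      map_smul' := fun _ _ => rfl }

@[simp]
lemma perp_apply (d : ℕ) (x : Euc (d + 1)) (i : Fin d) : perp d x i = x i.castSucc := rfl

/-- The embedding `ℝᵏ → {x⁺ = 0} ⊆ ℝ¹⁺ᵏ`. -/
def zeroPlus (k : ℕ) : Euc k →L[ℝ] Euc (k + 1) :=
  LinearMap.toContinuousLinearMap
    { toFun := fun x => WithLp.toLp 2 (Fin.cons 0 x.ofLp)
      map_add' := fun x y => by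
        ext i
        refine Fin.cases ?_ (fun i => ?_) i <;> simp
      map_smul' := fun c x => by
        ext i
        refine Fin.cases ?_ (fun i => ?_) i <;> simp }

@[simp]
lemma zeroPlus_apply_zero (k : ℕ) (x : Euc k) : zeroPlus k x 0 = 0 := rfl

@[simp]
lemma zeroPlus_apply_succ (k : ℕ) (x : Euc k) (i : Fin k) : zeroPlus k x i.succ = x i := rfl

lemma zeroPlus_e {k : ℕ} (j : Fin k) : zeroPlus k (e j) = e j.succ := by
  ext i
  refine Fin.cases ?_ (fun i => ?_) i
  · simp [(Fin.succ_ne_zero j).symm]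
  · simp [PiLp.single_apply]

@[simp]
lemma spatial_zeroPlus (k : ℕ) (x : Euc k) : spatial k (zeroPlus k x) = x := by
  ext i
  simp

@[simp]
lemma spatial_e_zero (k : ℕ) : spatial k (e 0) = 0 := by
  ext i
  simp [Fin.succ_ne_zero]

lemma norm_spatial_le (k : ℕ) (x : Euc (k + 1)) : ‖spatial k x‖ ≤ ‖x‖ := by
  have h : ‖x‖ ^ 2 = ‖x 0‖ ^ 2 + ‖spatial k x‖ ^ 2 := by
    rw [EuclideanSpace.norm_sq_eq, EuclideanSpace.norm_sq_eq, Fin.sum_univ_succ]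
    rfl
  exact le_of_sq_le_sq (by rw [h]; nlinarith [sq_nonneg ‖x 0‖]) (norm_nonneg _)

/-- The Fourier transform of `m² - Δ_⊥`. -/
def perpSymbol {d : ℕ} (m : ℝ) (η : Euc (d + 1)) : ℝ := m ^ 2 + 4 * Real.pi ^ 2 * ‖perp d η‖ ^ 2

lemma sq_le_perpSymbol {d : ℕ} (m : ℝ) (η : Euc (d + 1)) : m ^ 2 ≤ perpSymbol m η := by
  unfold perpSymbol
  have : 0 ≤ 4 * Real.pi ^ 2 * ‖perp d η‖ ^ 2 := by positivity
  linarith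

lemma perpSymbol_pos {d : ℕ} {m : ℝ} (hm : 0 < m) (η : Euc (d + 1)) : 0 < perpSymbol m η :=
  (pow_pos hm 2).trans_le (sq_le_perpSymbol m η)

/-- The Fourier transform of the light-cone Klein-Gordon operator. -/
def kgSymbol {d : ℕ} (m : ℝ) (ξ : Euc (d + 2)) : ℝ :=
  perpSymbol m (spatial (d + 1) ξ) - 8 * Real.pi ^ 2 * (ξ 0 * ξ (Fin.last (d + 1)))

/-- The value of `ξ⁺` on the mass shell. -/
def shellPlus {d : ℕ} (m : ℝ) (η : Euc (d + 1)) : ℝ :=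
  perpSymbol m η / (8 * Real.pi ^ 2 * η (Fin.last d))

/-- The point of the mass shell above `η`. -/
def shellPoint {d : ℕ} (m : ℝ) (η : Euc (d + 1)) : Euc (d + 2) :=
  shellPlus m η • e 0 + zeroPlus (d + 1) η

@[simp]
lemma shellPoint_zero {d : ℕ} (m : ℝ) (η : Euc (d + 1)) : shellPoint m η 0 = shellPlus m η := by
  simp [shellPoint]

@[simp]
lemma spatial_shellPoint {d : ℕ} (m : ℝ) (η : Euc (d + 1)) :
    spatial (d + 1) (shellPoint m η) = η := by
  simp [shellPoint]

@[simp]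
lemma shellPoint_succ {d : ℕ} (m : ℝ) (η : Euc (d + 1)) (i : Fin (d + 1)) :
    shellPoint m η i.succ = η i := by
  rw [← spatial_apply, spatial_shellPoint]

lemma shellPoint_last {d : ℕ} (m : ℝ) (η : Euc (d + 1)) :
    shellPoint m η (Fin.last (d + 1)) = η (Fin.last d) := by
  rw [← Fin.succ_last, shellPoint_succ]

lemma kgSymbol_shellPoint {d : ℕ} (m : ℝ) {η : Euc (d + 1)} (hη : η (Fin.last d) ≠ 0) :
    kgSymbol m (shellPoint m η) = 0 := by
  rw [kgSymbol, spatial_shellPoint, shellPoint_zero, shellPoint_last, shellPlus]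
  have := Real.pi_ne_zero
  field_simp
  ring

lemma shellPoint_spatial_of_kgSymbol_eq_zero {d : ℕ} {m : ℝ} {ξ : Euc (d + 2)}
    (hξ : ξ (Fin.last (d + 1)) ≠ 0) (h : kgSymbol m ξ = 0) :
    shellPoint m (spatial (d + 1) ξ) = ξ := by
  have h0 : shellPlus m (spatial (d + 1) ξ) = ξ 0 := by
    rw [shellPlus, spatial_apply, Fin.succ_last, div_eq_iff (by positivity)]
    unfold kgSymbol at h
    linear_combination h
  ext i
  refine Fin.cases ?_ (fun i => ?_) i
  · rw [shellPoint_zero, h0]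
  · rw [shellPoint_succ, spatial_apply]

/-- On the shell 1/ξ⁻ agrees with 8π²ξ⁺/(m² + 4π²|ξ_⊥|²), which is smooth of temperate growth on the
whole space. Singular factors along the shell are thereby replaced by admissible multipliers. At η⁻
= 0 both sides are zero by the convention for division. -/
lemma inv_last_eq {d : ℕ} {m : ℝ} (hm : 0 < m) (η : Euc (d + 1)) :
    (η (Fin.last d))⁻¹ = 8 * Real.pi ^ 2 * shellPlus m η / perpSymbol m η := by
  have := (perpSymbol_pos hm η).ne'
  have := Real.pi_ne_zero
  rw [shellPlus]
  by_cases h : η (Fin.last d) = 0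
  · simp [h]
  · field_simp

/-- The partial derivatives of `shellPlus`, multiplied by `ξ⁻`. -/
def shellCoeff {d : ℕ} (j : Fin (d + 1)) (ξ : Euc (d + 2)) : ℝ :=
  if j = Fin.last d then -ξ 0 else ξ j.succ

lemma hasFDerivAt_shellPlus {d : ℕ} (m : ℝ) {η : Euc (d + 1)} (hη : η (Fin.last d) ≠ 0) :
    ∃ L : Euc (d + 1) →L[ℝ] ℝ, HasFDerivAt (shellPlus m) L η ∧
      ∀ j, L (e j) = (η (Fin.last d))⁻¹ * shellCoeff j (shellPoint m η) := by
  have h1 : HasFDerivAt (fun η : Euc (d + 1) => ‖perp d η‖ ^ 2)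
      (2 • (innerSL ℝ (perp d η)).comp (perp d)) η :=
    (perp d).hasFDerivAt.norm_sq
  have h2 : HasFDerivAt (perpSymbol m) ((4 * Real.pi ^ 2) •
      (2 • (innerSL ℝ (perp d η)).comp (perp d))) η :=
    (h1.const_mul (4 * Real.pi ^ 2)).const_add (m ^ 2)
  have h3 : HasFDerivAt (fun η : Euc (d + 1) => 8 * Real.pi ^ 2 * η (Fin.last d))
      ((8 * Real.pi ^ 2) • (EuclideanSpace.proj (Fin.last d) : Euc (d + 1) →L[ℝ] ℝ)) η :=
    (EuclideanSpace.proj (Fin.last d) : Euc (d + 1) →L[ℝ] ℝ).hasFDerivAt.const_mul _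
  have hpi := Real.pi_ne_zero
  have h4 := h2.mul ((hasDerivAt_inv (by positivity :
    8 * Real.pi ^ 2 * η (Fin.last d) ≠ 0)).comp_hasFDerivAt η h3)
  refine ⟨_, h4.congr_of_eventuallyEq (Filter.Eventually.of_forall fun η => ?_), fun j => ?_⟩
  · simp [shellPlus, div_eq_mul_inv]
  · refine Fin.lastCases ?_ (fun i => ?_) j
    · have : perp d (e (Fin.last d)) = 0 := by
        ext i
        simp [Fin.castSucc_ne_last]
      simp [this, shellCoeff, shellPlus]
      field_simp
    · have : inner ℝ (perp d η) (perp d (e i.castSucc)) = η i.castSucc := by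
        have : perp d (e i.castSucc) = e i := by
          ext l
          simp [PiLp.single_apply]
        rw [this]
        simp [EuclideanSpace.inner_single_right]
      simp [this, shellCoeff, Fin.castSucc_ne_last]
      field_simp
      norm_num

lemma hasTemperateGrowth_coord {k : ℕ} (i : Fin k) :
    Function.HasTemperateGrowth fun ξ : Euc k => ((ξ i : ℝ) : ℂ) :=
  Function.Complex.hasTemperateGrowth_ofReal.comp (EuclideanSpace.proj i : Euc k →L[ℝ] ℝ).hasTemperateGrowth

lemma hasTemperateGrowth_perpSymbol {d : ℕ} (m : ℝ) :
    Function.HasTemperateGrowth (perpSymbol m : Euc (d + 1) → ℝ) := by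
  have h1 : Function.HasTemperateGrowth fun η : Euc (d + 1) => ‖perp d η‖ ^ 2 :=
    (Function.hasTemperateGrowth_norm_sq (H := Euc d)).comp (perp d).hasTemperateGrowth
  exact (Function.HasTemperateGrowth.const (m ^ 2)).add
    ((Function.HasTemperateGrowth.const (4 * Real.pi ^ 2)).mul h1)

lemma hasTemperateGrowth_kgSymbol {d : ℕ} (m : ℝ) :
    Function.HasTemperateGrowth (kgSymbol m : Euc (d + 2) → ℝ) := by
  have h1 : ∀ i, Function.HasTemperateGrowth fun ξ : Euc (d + 2) => ξ i := fun i =>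
    (EuclideanSpace.proj i : Euc (d + 2) →L[ℝ] ℝ).hasTemperateGrowth
  exact ((hasTemperateGrowth_perpSymbol m).comp (spatial (d + 1)).hasTemperateGrowth).sub
    ((Function.HasTemperateGrowth.const (8 * Real.pi ^ 2)).mul ((h1 0).mul (h1 (Fin.last _))))

/-- The symbol equals m²(1 + |(2π/m)η_⊥|²), so its inverse is a rescaled Bessel-type weight. -/
lemma hasTemperateGrowth_inv_perpSymbol {d : ℕ} {m : ℝ} (hm : 0 < m) :
    Function.HasTemperateGrowth fun η : Euc (d + 1) => (perpSymbol m η)⁻¹ := by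
  have h1 := (Function.hasTemperateGrowth_one_add_norm_sq_rpow (H := Euc d) (-1)).comp
    (((2 * Real.pi / m) • perp d).hasTemperateGrowth)
  have h2 := (Function.HasTemperateGrowth.const (m ^ 2)⁻¹).mul h1
  have h3 : (fun η : Euc (d + 1) => (perpSymbol m η)⁻¹) = (fun _ => (m ^ 2)⁻¹) *
      ((fun x : Euc d => (1 + ‖x‖ ^ 2) ^ (-1 : ℝ)) ∘ ⇑((2 * Real.pi / m) • perp d)) := ?_
  · rw [h3]
    exact h2
  funext η
  simp only [Pi.mul_apply, Function.comp_apply, smul_apply, norm_smul,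
    Real.norm_eq_abs, mul_pow, sq_abs, Real.rpow_neg_one]
  rw [← mul_inv, perpSymbol]
  congr 1
  field_simp
  ring

/-! ### Restriction to the mass shell -/

/-- The Schwartz functions on `ℝᵏ⁺¹` which are divisible by all powers of the last coordinate: the
Fourier transforms of the elements of `S_{∂₋}(ℝᵏ⁺¹)`. -/
def hatTame (k : ℕ) : Submodule ℂ 𝓢(Euc (k + 1), ℂ) :=
  ⨅ n : ℕ, LinearMap.range (SchwartzMap.smulLeftCLM ℂ
    (fun η : Euc (k + 1) => ((η (Fin.last k) : ℝ) : ℂ) ^ n)).toLinearMap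

lemma hasTemperateGrowth_coord_pow {k : ℕ} (i : Fin k) (n : ℕ) :
    Function.HasTemperateGrowth fun ξ : Euc k => ((ξ i : ℝ) : ℂ) ^ n :=
  (hasTemperateGrowth_coord i).pow n

lemma mem_hatTame {k : ℕ} {G : 𝓢(Euc (k + 1), ℂ)} :
    G ∈ hatTame k ↔ ∀ n : ℕ, ∃ H : 𝓢(Euc (k + 1), ℂ),
      ∀ η, G η = ((η (Fin.last k) : ℝ) : ℂ) ^ n * H η := by
  simp only [hatTame, Submodule.mem_iInf, LinearMap.mem_range]
  refine forall_congr' fun n => exists_congr fun H => ?_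
  rw [DFunLike.ext_iff]
  refine forall_congr' fun η => ?_
  rw [ContinuousLinearMap.coe_coe,
    SchwartzMap.smulLeftCLM_apply_apply (hasTemperateGrowth_coord_pow _ n), smul_eq_mul, eq_comm]

lemma hatTame_apply_eq_zero {k : ℕ} {G : 𝓢(Euc (k + 1), ℂ)} (hG : G ∈ hatTame k)
    {η : Euc (k + 1)} (hη : η (Fin.last k) = 0) : G η = 0 := by
  obtain ⟨H, hH⟩ := mem_hatTame.1 hG 1
  rw [hH, hη]
  simp

lemma norm_shellPoint_ge {d : ℕ} (m : ℝ) (η : Euc (d + 1)) : ‖η‖ ≤ ‖shellPoint m η‖ := by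
  simpa using norm_spatial_le (d + 1) (shellPoint m η)

open Classical in
/-- `Φ ↦ Φ|_shell` as a linear map. -/
def shellRestrictionAux {d : ℕ} (m : ℝ) : 𝓢(Euc (d + 2), ℂ) →ₗ[ℂ] (Euc (d + 1) → ℂ) where
  toFun Φ η := if η (Fin.last d) = 0 then 0 else Φ (shellPoint m η)
  map_add' Φ Ψ := by
    funext η
    by_cases h : η (Fin.last d) = 0 <;> simp [h]
  map_smul' c Φ := by
    funext η
    by_cases h : η (Fin.last d) = 0 <;> simp [h]

lemma shellRestrictionAux_of_eq {d : ℕ} (m : ℝ) (Φ : 𝓢(Euc (d + 2), ℂ)) {η : Euc (d + 1)}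
    (h : η (Fin.last d) = 0) : shellRestrictionAux m Φ η = 0 := if_pos h

lemma shellRestrictionAux_of_ne {d : ℕ} (m : ℝ) (Φ : 𝓢(Euc (d + 2), ℂ)) {η : Euc (d + 1)}
    (h : η (Fin.last d) ≠ 0) : shellRestrictionAux m Φ η = Φ (shellPoint m η) := if_neg h

/-- The coefficient of `∂₊` in the derivation along the mass shell in the `j`-th direction. -/
def shellField {d : ℕ} (m : ℝ) (j : Fin (d + 1)) (ξ : Euc (d + 2)) : ℂ :=
  ((8 * Real.pi ^ 2 * ξ 0 * (perpSymbol m (spatial (d + 1) ξ))⁻¹ * shellCoeff j ξ : ℝ) : ℂ)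

lemma hasTemperateGrowth_proj {k : ℕ} (i : Fin k) :
    Function.HasTemperateGrowth fun ξ : Euc k => ξ i :=
  (EuclideanSpace.proj i : Euc k →L[ℝ] ℝ).hasTemperateGrowth

lemma hasTemperateGrowth_shellCoeff {d : ℕ} (j : Fin (d + 1)) :
    Function.HasTemperateGrowth (shellCoeff j : Euc (d + 2) → ℝ) := by
  unfold shellCoeff
  by_cases h : j = Fin.last d
  · simp only [h, if_true]
    exact (hasTemperateGrowth_proj 0).neg
  · simp only [h, if_false]
    exact hasTemperateGrowth_proj _

lemma hasTemperateGrowth_inv_last {d : ℕ} {m : ℝ} (hm : 0 < m) :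
    Function.HasTemperateGrowth fun ξ : Euc (d + 2) =>
      8 * Real.pi ^ 2 * ξ 0 * (perpSymbol m (spatial (d + 1) ξ))⁻¹ :=
  ((Function.HasTemperateGrowth.const _).mul (hasTemperateGrowth_proj 0)).mul
    ((hasTemperateGrowth_inv_perpSymbol hm).comp (spatial (d + 1)).hasTemperateGrowth)

lemma hasTemperateGrowth_shellField {d : ℕ} {m : ℝ} (hm : 0 < m) (j : Fin (d + 1)) :
    Function.HasTemperateGrowth (shellField m j : Euc (d + 2) → ℂ) :=
  Function.Complex.hasTemperateGrowth_ofReal.comp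
    ((hasTemperateGrowth_inv_last hm).mul (hasTemperateGrowth_shellCoeff j))

/-- The derivation along the mass shell in the `j`-th direction. -/
def shellDerivation {d : ℕ} (m : ℝ) (j : Fin (d + 1)) :
    𝓢(Euc (d + 2), ℂ) →L[ℂ] 𝓢(Euc (d + 2), ℂ) :=
  LineDeriv.lineDerivOpCLM ℂ 𝓢(Euc (d + 2), ℂ) (e j.succ) +
    (SchwartzMap.smulLeftCLM ℂ (shellField m j)).comp
      (LineDeriv.lineDerivOpCLM ℂ 𝓢(Euc (d + 2), ℂ) (e (0 : Fin (d + 2))))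

lemma shellDerivation_apply {d : ℕ} {m : ℝ} (hm : 0 < m) (j : Fin (d + 1))
    (Φ : 𝓢(Euc (d + 2), ℂ)) (ξ : Euc (d + 2)) : shellDerivation m j Φ ξ =
      (∂_{e j.succ} Φ) ξ + shellField m j ξ * (∂_{e (0 : Fin (d + 2))} Φ) ξ := by
  change (∂_{e j.succ} Φ) ξ + SchwartzMap.smulLeftCLM ℂ (shellField m j) (∂_{e (0 : Fin (d + 2))} Φ) ξ = _
  rw [SchwartzMap.smulLeftCLM_apply_apply (hasTemperateGrowth_shellField hm j), smul_eq_mul]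

/-- Off η⁻ = 0 this is the chain rule, with 1/η⁻ rewritten by `inv_last_eq` so that the derivative
is again the restriction of a Schwartz function. At η⁻ = 0 the derivative vanishes, because nearby
shell points are far away and Φ decays. -/
lemma shellRestrictionAux_hasFDerivAt {d : ℕ} {m : ℝ} (hm : 0 < m) (Φ : 𝓢(Euc (d + 2), ℂ))
    (η : Euc (d + 1)) : HasFDerivAt (shellRestrictionAux m Φ)
      (covector fun j => shellRestrictionAux m (shellDerivation m j Φ) η) η := by
  by_cases h : η (Fin.last d) = 0
  · simp only [shellRestrictionAux_of_eq m _ h, covector_zero]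
    obtain ⟨q, -, hq⟩ := exists_weight_seminorm (d + 2) 2
    have hm2 : 0 < m ^ 2 := by positivity
    have hbound : ∀ η' : Euc (d + 1), ‖shellRestrictionAux m Φ η'‖ ≤
        q Φ * (8 * Real.pi ^ 2 / m ^ 2) ^ 2 * ‖η' - η‖ ^ 2 := by
      intro η'
      by_cases h' : η' (Fin.last d) = 0
      · rw [shellRestrictionAux_of_eq m _ h', norm_zero]
        positivity
      · rw [shellRestrictionAux_of_ne m _ h']
        have h1 : |η' (Fin.last d)| ≤ ‖η' - η‖ := by
          have := PiLp.norm_apply_le (η' - η) (Fin.last d)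
          simpa [h] using this
        -- On the shell 8π²|ξ⁺||ξ⁻| ≥ m²: distance to the hyperplane is bounded below by the inverse
        -- of the norm. Squaring this turns quadratic decay of Φ into a quadratic bound in η' − η.
        have h2 : 1 ≤ (8 * Real.pi ^ 2 / m ^ 2) * |η' (Fin.last d)| * ‖shellPoint m η'‖ := by
          have h3 : |shellPlus m η'| ≤ ‖shellPoint m η'‖ := by
            simpa using PiLp.norm_apply_le (shellPoint m η') 0
          have h4 : 1 ≤ (8 * Real.pi ^ 2 / m ^ 2) * |η' (Fin.last d)| * |shellPlus m η'| := by
            have habs : 0 < |η' (Fin.last d)| := abs_pos.2 h'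
            rw [shellPlus, abs_div, abs_mul, abs_of_pos (perpSymbol_pos hm η'),
              abs_of_pos (by positivity : 0 < 8 * Real.pi ^ 2)]
            have h5 := sq_le_perpSymbol m η'
            have h6 : (8 * Real.pi ^ 2 / m ^ 2) * |η' (Fin.last d)| *
                (perpSymbol m η' / (8 * Real.pi ^ 2 * |η' (Fin.last d)|)) =
                perpSymbol m η' / m ^ 2 := by
              have := Real.pi_ne_zero
              field_simp
            rw [h6, le_div_iff₀ hm2, one_mul]
            exact h5
          exact h4.trans (by gcongr)
        have h7 : 1 ≤ ((8 * Real.pi ^ 2 / m ^ 2) * ‖η' - η‖ * (1 + ‖shellPoint m η'‖)) := by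
          refine h2.trans ?_
          gcongr
          linarith
        calc ‖Φ (shellPoint m η')‖ ≤
            ((8 * Real.pi ^ 2 / m ^ 2) * ‖η' - η‖ * (1 + ‖shellPoint m η'‖)) ^ 2 *
              ‖Φ (shellPoint m η')‖ := le_mul_of_one_le_left (norm_nonneg _) (one_le_pow₀ h7)
          _ = (8 * Real.pi ^ 2 / m ^ 2) ^ 2 * ‖η' - η‖ ^ 2 *
              ((1 + ‖shellPoint m η'‖) ^ 2 * ‖Φ (shellPoint m η')‖) := by
            simp only [mul_pow, mul_assoc]
          _ ≤ (8 * Real.pi ^ 2 / m ^ 2) ^ 2 * ‖η' - η‖ ^ 2 * q Φ := by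
            gcongr
            exact hq _ _
          _ = _ := by ring
    rw [hasFDerivAt_iff_isLittleO_nhds_zero]
    have hO : (fun v => shellRestrictionAux m Φ (η + v) - shellRestrictionAux m Φ η -
        (0 : Euc (d + 1) →L[ℝ] ℂ) v) =O[nhds 0] fun v : Euc (d + 1) => ‖v‖ ^ 2 := by
      refine Asymptotics.IsBigO.of_bound (q Φ * (8 * Real.pi ^ 2 / m ^ 2) ^ 2)
        (Filter.Eventually.of_forall fun v => ?_)
      rw [shellRestrictionAux_of_eq m _ h]
      simpa using hbound (η + v)
    exact hO.trans_isLittleO (Asymptotics.isLittleO_norm_pow_id one_lt_two)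
  · obtain ⟨L, hL, hLe⟩ := hasFDerivAt_shellPlus m h
    have h1 : HasFDerivAt (shellPoint m) (L.smulRight (e 0) + zeroPlus (d + 1)) η :=
      (hL.smul_const (e 0)).add (zeroPlus (d + 1)).hasFDerivAt
    have h2 := ((Φ.hasFDerivAt (shellPoint m η)).comp η h1)
    have hev : shellRestrictionAux m Φ =ᶠ[nhds η] Φ ∘ shellPoint m := by
      have hopen : IsOpen {η : Euc (d + 1) | η (Fin.last d) ≠ 0} :=
        isOpen_ne_fun (by fun_prop) continuous_const
      filter_upwards [hopen.mem_nhds h] with η' hη'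
      exact shellRestrictionAux_of_ne m Φ hη'
    refine HasFDerivAt.covector (h2.congr_of_eventuallyEq hev) fun j => ?_
    rw [shellRestrictionAux_of_ne m _ h, shellDerivation_apply hm]
    have h3 : (L.smulRight (e (0 : Fin (d + 2))) + zeroPlus (d + 1)) (e j) =
        L (e j) • e (0 : Fin (d + 2)) + e j.succ := by
      rw [add_apply, zeroPlus_e]
      rfl
    rw [ContinuousLinearMap.comp_apply, h3, map_add, map_smul,
      SchwartzMap.lineDerivOp_apply_eq_fderiv, SchwartzMap.lineDerivOp_apply_eq_fderiv, add_comm,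
      hLe, shellField, spatial_shellPoint, shellPoint_zero, inv_last_eq hm η, Complex.real_smul]
    simp only [div_eq_mul_inv]

lemma exists_shellRestriction {d : ℕ} {m : ℝ} (hm : 0 < m) :
    ∃ T : 𝓢(Euc (d + 2), ℂ) →L[ℂ] 𝓢(Euc (d + 1), ℂ),
      ∀ Φ η, T Φ η = shellRestrictionAux m Φ η := by
  refine exists_schwartz_lift (A := shellRestrictionAux m)
    (𝒢 := {A | ∃ D : 𝓢(Euc (d + 2), ℂ) →L[ℂ] 𝓢(Euc (d + 2), ℂ),
      A = (shellRestrictionAux m).comp D.toLinearMap}) ?_ ?_ ⟨ContinuousLinearMap.id ℂ _, rfl⟩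
  · rintro _ ⟨D, rfl⟩
    exact ⟨fun j => (shellRestrictionAux m).comp ((shellDerivation m j).comp D).toLinearMap,
      fun j => AddSubmonoid.subset_closure ⟨_, rfl⟩,
      fun Φ η => shellRestrictionAux_hasFDerivAt hm (D Φ) η⟩
  · rintro _ ⟨D, rfl⟩ M
    obtain ⟨q, hq, hqb⟩ := exists_weight_seminorm (d + 2) M
    refine ⟨q.comp D.toLinearMap, hq.comp D.continuous, fun Φ η => ?_⟩
    change ‖η‖ ^ M * ‖shellRestrictionAux m (D Φ) η‖ ≤ q (D Φ)
    by_cases h : η (Fin.last d) = 0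
    · rw [shellRestrictionAux_of_eq m _ h, norm_zero, mul_zero]
      exact apply_nonneg _ _
    · rw [shellRestrictionAux_of_ne m _ h]
      refine le_trans ?_ (hqb (D Φ) (shellPoint m η))
      gcongr
      linarith [norm_shellPoint_ge m η]

/-- The restriction of Schwartz functions to the mass shell, parametrized by `(ξ_⊥, ξ⁻)`. -/
def shellRestriction {d : ℕ} {m : ℝ} (hm : 0 < m) :
    𝓢(Euc (d + 2), ℂ) →L[ℂ] 𝓢(Euc (d + 1), ℂ) :=
  (exists_shellRestriction hm).choose

lemma shellRestriction_of_eq {d : ℕ} {m : ℝ} (hm : 0 < m) (Φ : 𝓢(Euc (d + 2), ℂ))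
    {η : Euc (d + 1)} (h : η (Fin.last d) = 0) : shellRestriction hm Φ η = 0 :=
  ((exists_shellRestriction hm).choose_spec Φ η).trans (shellRestrictionAux_of_eq m Φ h)

lemma shellRestriction_of_ne {d : ℕ} {m : ℝ} (hm : 0 < m) (Φ : 𝓢(Euc (d + 2), ℂ))
    {η : Euc (d + 1)} (h : η (Fin.last d) ≠ 0) :
    shellRestriction hm Φ η = Φ (shellPoint m η) :=
  ((exists_shellRestriction hm).choose_spec Φ η).trans (shellRestrictionAux_of_ne m Φ h)

/-- Division by the n-th power of η⁻ after restriction is multiplication by the n-th power of the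
multiplier of `inv_last_eq` before it. -/
lemma shellRestriction_mem_hatTame {d : ℕ} {m : ℝ} (hm : 0 < m) (Φ : 𝓢(Euc (d + 2), ℂ)) :
    shellRestriction hm Φ ∈ hatTame d := by
  refine mem_hatTame.2 fun n => ?_
  have hg : Function.HasTemperateGrowth fun ξ : Euc (d + 2) =>
      ((8 * Real.pi ^ 2 * ξ 0 * (perpSymbol m (spatial (d + 1) ξ))⁻¹ : ℝ) : ℂ) ^ n :=
    (Function.Complex.hasTemperateGrowth_ofReal.comp (hasTemperateGrowth_inv_last hm)).pow n
  refine ⟨shellRestriction hm (SchwartzMap.smulLeftCLM ℂ (fun ξ : Euc (d + 2) =>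
      ((8 * Real.pi ^ 2 * ξ 0 * (perpSymbol m (spatial (d + 1) ξ))⁻¹ : ℝ) : ℂ) ^ n) Φ),
    fun η => ?_⟩
  · by_cases h : η (Fin.last d) = 0
    · rw [shellRestriction_of_eq hm _ h, shellRestriction_of_eq hm _ h, mul_zero]
    · rw [shellRestriction_of_ne hm _ h, shellRestriction_of_ne hm _ h,
        SchwartzMap.smulLeftCLM_apply_apply hg, spatial_shellPoint, shellPoint_zero,
        ← div_eq_mul_inv, ← inv_last_eq hm, Complex.ofReal_inv, smul_eq_mul, ← mul_assoc,
        ← mul_pow, mul_inv_cancel₀ (Complex.ofReal_ne_zero.2 h), one_pow, one_mul]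

/-! ### Bounds for quotients by powers of a linear function -/

/-- A division estimate: the quotient by (τ − a)ᵏ is controlled by the k-th derivative, uniformly in
a. -/
lemma norm_le_of_iteratedDeriv_pow_mul {a C : ℝ} (k : ℕ) {g : ℝ → ℂ} (hg : ContDiff ℝ ∞ g)
    (h : ∀ τ, ‖iteratedDeriv k (fun τ : ℝ => ((τ - a : ℝ) : ℂ) ^ k * g τ) τ‖ ≤ C) (b : ℝ) :
    ‖g b‖ ≤ C := by
  induction k generalizing g b with
  | zero => simpa using h b
  | succ k ih =>
    -- Chosen so that ((τ − a)^{k+1} g)' = (τ − a)ᵏ g₁. Induction bounds g₁, and the mean value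
    -- inequality from a to b returns to g; at b = a one reads off g₁(a) = (k+1) g(a).
    set g₁ : ℝ → ℂ := fun τ => (k + 1 : ℂ) * g τ + ((τ - a : ℝ) : ℂ) * deriv g τ
    have hd : ∀ τ : ℝ, HasDerivAt (fun τ : ℝ => ((τ - a : ℝ) : ℂ) ^ (k + 1) * g τ)
        (((τ - a : ℝ) : ℂ) ^ k * g₁ τ) τ := by
      intro τ
      have h1 : HasDerivAt (fun τ : ℝ => ((τ - a : ℝ) : ℂ)) 1 τ := by
        simpa using ((hasDerivAt_id τ).sub_const a).ofReal_comp
      have h2 := (h1.fun_pow (k + 1)).mul ((hg.differentiable (by simp)) τ).hasDerivAt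
      refine h2.congr_deriv ?_
      simp only [g₁, Nat.add_sub_cancel, Nat.cast_add, Nat.cast_one]
      ring
    have hofReal : ContDiff ℝ ∞ fun τ : ℝ => ((τ - a : ℝ) : ℂ) :=
      Complex.ofRealCLM.contDiff.comp (contDiff_id.sub contDiff_const)
    have hg₁ : ContDiff ℝ ∞ g₁ :=
      (contDiff_const.mul hg).add (hofReal.mul (contDiff_infty_iff_deriv.1 hg).2)
    have hb₁ : ∀ τ, ‖g₁ τ‖ ≤ C := by
      refine ih hg₁ fun τ => ?_
      have := h τ
      rwa [iteratedDeriv_succ', funext fun τ => (hd τ).deriv] at this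
    by_cases hba : b = a
    · subst hba
      have h1 := hb₁ b
      simp only [g₁, sub_self, Complex.ofReal_zero, zero_mul, add_zero, norm_mul] at h1
      have h2 : (1 : ℝ) ≤ ‖(k + 1 : ℂ)‖ := by
        have : ((k + 1 : ℕ) : ℂ) = (k + 1 : ℂ) := by push_cast; rfl
        rw [← this, Complex.norm_natCast]
        exact_mod_cast Nat.succ_le_succ (Nat.zero_le k)
      exact (le_mul_of_one_le_left (norm_nonneg _) h2).trans h1
    · have hpos : 0 < |b - a| := abs_pos.2 (sub_ne_zero.2 hba)
      have h1 := (convex_uIcc a b).norm_image_sub_le_of_norm_hasDerivWithin_le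
        (C := |b - a| ^ k * C) (fun τ _ => (hd τ).hasDerivWithinAt) (fun τ hτ => by
          rw [norm_mul, norm_pow, Complex.norm_real, Real.norm_eq_abs]
          have h2 := Set.abs_sub_left_of_mem_uIcc hτ
          exact mul_le_mul (pow_le_pow_left₀ (abs_nonneg _) h2 k) (hb₁ τ) (norm_nonneg _)
            (by positivity)) Set.left_mem_uIcc Set.right_mem_uIcc
      rw [sub_self, Complex.ofReal_zero, zero_pow (Nat.succ_ne_zero k), zero_mul, sub_zero,
        norm_mul, norm_pow, Complex.norm_real, Real.norm_eq_abs, mul_right_comm, ← pow_succ] at h1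
      exact le_of_mul_le_mul_left h1 (by positivity)

/-- The `n`-th derivative in direction `v`. -/
def iterDeriv {k : ℕ} (v : Euc k) (n : ℕ) : 𝓢(Euc k, ℂ) →L[ℂ] 𝓢(Euc k, ℂ) :=
  LineDeriv.lineDerivOpCLM ℂ 𝓢(Euc k, ℂ) v ^ n

lemma iteratedDeriv_line {k : ℕ} (x v : Euc k) (n : ℕ) (Φ : 𝓢(Euc k, ℂ)) :
    iteratedDeriv n (fun τ : ℝ => Φ (x + τ • v)) = fun τ => iterDeriv v n Φ (x + τ • v) := by
  induction n generalizing Φ with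
  | zero => rw [iteratedDeriv_zero]; rfl
  | succ n ih =>
    have hd : ∀ τ : ℝ, HasDerivAt (fun τ : ℝ => Φ (x + τ • v)) ((∂_{v} Φ) (x + τ • v)) τ := by
      intro τ
      have h1 : HasDerivAt (fun τ : ℝ => x + τ • v) v τ := by
        simpa using ((hasDerivAt_id τ).smul_const v).const_add x
      exact (Φ.hasFDerivAt (x + τ • v)).comp_hasDerivAt τ h1
    rw [iteratedDeriv_succ', funext fun τ => (hd τ).deriv, ih (∂_{v} Φ)]
    simp only [iterDeriv, pow_succ]
    rfl

lemma norm_le_seminorm_iterDeriv {k n : ℕ} {Φ : 𝓢(Euc k, ℂ)} {x v : Euc k} {a : ℝ} {g : ℝ → ℂ}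
    (hg : ContDiff ℝ ∞ g) (h : ∀ τ : ℝ, Φ (x + τ • v) = ((τ - a : ℝ) : ℂ) ^ n * g τ) :
    ‖g 0‖ ≤ SchwartzMap.seminorm ℂ 0 0 (iterDeriv v n Φ) := by
  refine norm_le_of_iteratedDeriv_pow_mul n (a := a) hg (fun τ => ?_) 0
  rw [← funext h, iteratedDeriv_line]
  exact SchwartzMap.norm_le_seminorm ℂ _ _

/-- The weight `(1 + |x|²)ᴹ`. -/
def weight {k : ℕ} (M : ℕ) (x : Euc k) : ℂ := ((1 + ‖x‖ ^ 2 : ℝ) : ℂ) ^ M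

lemma hasTemperateGrowth_weight {k : ℕ} (M : ℕ) :
    Function.HasTemperateGrowth (weight M : Euc k → ℂ) :=
  (Function.Complex.hasTemperateGrowth_ofReal.comp
    ((Function.HasTemperateGrowth.const 1).add
      (Function.hasTemperateGrowth_norm_sq (H := Euc k)))).pow M

lemma weight_le {k : ℕ} (M : ℕ) (x : Euc k) : (1 + ‖x‖) ^ M ≤ 2 ^ M * ‖weight M x‖ := by
  rw [weight, norm_pow, Complex.norm_real, Real.norm_of_nonneg (by positivity), ← mul_pow]
  refine pow_le_pow_left₀ (by positivity) ?_ M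
  nlinarith [sq_nonneg (‖x‖ - 1), norm_nonneg x]

/-- The division estimate along the last coordinate, applied to the weighted function, bounds the
quotient of G by a seminorm of G itself. This is what makes the extension from the shell continuous.
-/
lemma exists_flat_seminorm (k M n : ℕ) : ∃ q : Seminorm ℂ 𝓢(Euc (k + 1), ℂ), Continuous q ∧
    ∀ G ∈ hatTame k, ∀ η, (1 + ‖η‖) ^ M * ‖G η‖ ≤ |η (Fin.last k)| ^ n * q G := by
  let P := SchwartzMap.smulLeftCLM ℂ (weight M : Euc (k + 1) → ℂ)
  let D := (iterDeriv (e (Fin.last k)) n).comp P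
  refine ⟨(2 : NNReal) ^ M • (SchwartzMap.seminorm ℂ 0 0).comp D.toLinearMap,
    (((schwartz_withSeminorms ℂ _ ℂ).continuous_seminorm (0, 0)).comp D.continuous).const_smul _,
    fun G hG η => ?_⟩
  obtain ⟨H, hH⟩ := mem_hatTame.1 hG n
  have hP : ∀ (F : 𝓢(Euc (k + 1), ℂ)) x, P F x = weight M x * F x := fun F x => by
    rw [SchwartzMap.smulLeftCLM_apply_apply (hasTemperateGrowth_weight M), smul_eq_mul]
  have h1 := norm_le_seminorm_iterDeriv (Φ := P G) (x := η) (v := e (Fin.last k))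
    (a := -η (Fin.last k)) (n := n) (g := fun τ => P H (η + τ • e (Fin.last k)))
    (((P H).smooth ⊤).comp (by fun_prop)) (fun τ => by
      rw [hP, hP, hH]
      simp
      ring)
  simp only [zero_smul, add_zero, hP, norm_mul] at h1
  change _ ≤ |η (Fin.last k)| ^ n * (2 ^ M * SchwartzMap.seminorm ℂ 0 0 (D G))
  calc (1 + ‖η‖) ^ M * ‖G η‖ ≤ (2 ^ M * ‖weight M η‖) * ‖G η‖ := by
        gcongr
        exact weight_le M η
    _ = |η (Fin.last k)| ^ n * (2 ^ M * (‖weight M η‖ * ‖H η‖)) := by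
        rw [hH, norm_mul, norm_pow, Complex.norm_real, Real.norm_eq_abs]
        ring
    _ ≤ _ := by
        gcongr
        exact h1

/-! ### Extension from the mass shell -/

lemma HasTemperateGrowth.fderiv_apply {k : ℕ} {a : Euc k → ℂ} (ha : a.HasTemperateGrowth)
    (v : Euc k) : Function.HasTemperateGrowth fun x => fderiv ℝ a x v := by
  have h1 : Function.HasTemperateGrowth (fderiv ℝ a) := by
    refine ⟨(contDiff_infty_iff_fderiv.1 ha.1).2, fun n => ?_⟩
    obtain ⟨K, C, h⟩ := ha.2 (n + 1)
    exact ⟨K, C, fun x => by rw [norm_iteratedFDeriv_fderiv]; exact h x⟩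
  exact ((ContinuousLinearMap.apply ℝ ℂ v).hasTemperateGrowth).comp h1

lemma lineDerivOp_mem_hatTame {k : ℕ} {G : 𝓢(Euc (k + 1), ℂ)} (hG : G ∈ hatTame k)
    (v : Euc (k + 1)) : ∂_{v} G ∈ hatTame k := by
  refine mem_hatTame.2 fun n => ?_
  -- One spare power, because the product rule may differentiate a factor η⁻.
  obtain ⟨H, hH⟩ := mem_hatTame.1 hG (n + 1)
  refine ⟨SchwartzMap.smulLeftCLM ℂ (fun η : Euc (k + 1) => ((η (Fin.last k) : ℝ) : ℂ)) (∂_{v} H) +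
    ((n + 1) * (v (Fin.last k)) : ℂ) • H, fun η => ?_⟩
  have h1 : HasFDerivAt (fun η : Euc (k + 1) => ((η (Fin.last k) : ℝ) : ℂ))
      (Complex.ofRealCLM.comp (EuclideanSpace.proj (Fin.last k) : Euc (k + 1) →L[ℝ] ℝ)) η :=
    (Complex.ofRealCLM.comp (EuclideanSpace.proj (Fin.last k) :
      Euc (k + 1) →L[ℝ] ℝ)).hasFDerivAt
  have h2 := (h1.pow (n + 1)).mul (H.hasFDerivAt η)
  have h3 : HasFDerivAt G _ η := h2.congr_of_eventuallyEq (Filter.Eventually.of_forall hH)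
  rw [SchwartzMap.lineDerivOp_apply_eq_fderiv, h3.fderiv, add_apply, smul_apply, add_apply,
    smul_apply, SchwartzMap.smulLeftCLM_apply_apply (hasTemperateGrowth_coord _),
    SchwartzMap.lineDerivOp_apply_eq_fderiv]
  simp
  ring

/-- Smooth functions of temperate growth supported near the mass shell. -/
def IsShellCutoff {d : ℕ} (m : ℝ) (a : Euc (d + 2) → ℂ) : Prop :=
  a.HasTemperateGrowth ∧ ∀ ξ, m ^ 2 / 2 < |kgSymbol m ξ| → a ξ = 0

lemma IsShellCutoff.fderiv_apply {d : ℕ} {m : ℝ} {a : Euc (d + 2) → ℂ} (ha : IsShellCutoff m a)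
    (v : Euc (d + 2)) : IsShellCutoff m fun ξ => fderiv ℝ a ξ v := by
  refine ⟨HasTemperateGrowth.fderiv_apply ha.1 v, fun ξ hξ => ?_⟩
  have hopen : IsOpen {ξ : Euc (d + 2) | m ^ 2 / 2 < |kgSymbol m ξ|} :=
    isOpen_lt continuous_const (hasTemperateGrowth_kgSymbol m).1.continuous.abs
  have h1 : a =ᶠ[nhds ξ] fun _ => (0 : ℂ) := by
    filter_upwards [hopen.mem_nhds hξ] with ξ' hξ'
    exact ha.2 ξ' hξ'
  simp only [h1.fderiv_eq]
  simp

/-- On ξ⁻ = 0 the symbol is at least m², so a neighbourhood of the shell avoids this hyperplane. The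
mass must be positive here. -/
lemma last_ne_zero_of_abs_kgSymbol_le {d : ℕ} {m : ℝ} (hm : 0 < m) {ξ : Euc (d + 2)}
    (h : |kgSymbol m ξ| ≤ m ^ 2 / 2) : ξ (Fin.last (d + 1)) ≠ 0 := by
  intro h0
  have h1 := (abs_le.1 h).2
  rw [kgSymbol, h0, mul_zero, mul_zero, sub_zero] at h1
  nlinarith [sq_le_perpSymbol m (spatial (d + 1) ξ), pow_pos hm 2]

lemma norm_perp_le {d : ℕ} (η : Euc (d + 1)) : ‖perp d η‖ ≤ ‖η‖ := by
  have h : ‖η‖ ^ 2 = ‖perp d η‖ ^ 2 + ‖η (Fin.last d)‖ ^ 2 := by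
    rw [EuclideanSpace.norm_sq_eq, EuclideanSpace.norm_sq_eq, Fin.sum_univ_castSucc]
    rfl
  exact le_of_sq_le_sq (by rw [h]; nlinarith [sq_nonneg ‖η (Fin.last d)‖]) (norm_nonneg _)

/-- Near the shell ξ⁺ξ⁻ is at most quadratic in (ξ_⊥, ξ⁻). Growth in ξ⁺ thus costs powers of 1/ξ⁻,
which flatness at ξ⁻ = 0 pays for. -/
lemma one_add_norm_mul_last_le {d : ℕ} {m : ℝ} {ξ : Euc (d + 2)}
    (h : |kgSymbol m ξ| ≤ m ^ 2 / 2) :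
    (1 + ‖ξ‖) * |ξ (Fin.last (d + 1))| ≤ (m ^ 2 + 2) * (1 + ‖spatial (d + 1) ξ‖) ^ 2 := by
  set N := ‖spatial (d + 1) ξ‖
  have hN : 0 ≤ N := norm_nonneg _
  have h1 : |ξ (Fin.last (d + 1))| ≤ N := by
    have := PiLp.norm_apply_le (spatial (d + 1) ξ) (Fin.last d)
    rwa [spatial_apply, Fin.succ_last, Real.norm_eq_abs] at this
  have h2 : ‖ξ‖ ≤ |ξ 0| + N := norm_le_plusCoord_add_spatial _ _
  have hpi : 9 ≤ Real.pi ^ 2 := by nlinarith [Real.pi_gt_three]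
  have h3 : |ξ 0 * ξ (Fin.last (d + 1))| ≤ (m ^ 2 + 1) * (1 + N ^ 2) := by
    have h4 : 8 * Real.pi ^ 2 * |ξ 0 * ξ (Fin.last (d + 1))| ≤
        3 / 2 * m ^ 2 + 4 * Real.pi ^ 2 * N ^ 2 := by
      have h5 : 8 * Real.pi ^ 2 * (ξ 0 * ξ (Fin.last (d + 1))) =
          perpSymbol m (spatial (d + 1) ξ) - kgSymbol m ξ := by
        rw [kgSymbol]
        ring
      have h6 : perpSymbol m (spatial (d + 1) ξ) ≤ m ^ 2 + 4 * Real.pi ^ 2 * N ^ 2 := by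
        unfold perpSymbol
        gcongr
        exact norm_perp_le _
      have h7 := sq_le_perpSymbol m (spatial (d + 1) ξ)
      rw [← abs_of_pos (by positivity : 0 < 8 * Real.pi ^ 2), ← abs_mul, h5, abs_le]
      constructor <;> nlinarith [abs_le.1 h, sq_nonneg m, (abs_le.1 h).1, (abs_le.1 h).2]
    have h8 : 0 ≤ Real.pi ^ 2 * m ^ 2 := by positivity
    have h9 : 0 ≤ Real.pi ^ 2 * N ^ 2 := by positivity
    have h10 : 0 ≤ Real.pi ^ 2 * (m ^ 2 * N ^ 2) := by positivity
    refine le_of_mul_le_mul_left (h4.trans ?_) (by positivity : 0 < 8 * Real.pi ^ 2)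
    nlinarith [mul_nonneg (sub_nonneg.2 hpi) (sq_nonneg m)]
  rw [abs_mul] at h3
  calc (1 + ‖ξ‖) * |ξ (Fin.last (d + 1))|
      ≤ (1 + (|ξ 0| + N)) * |ξ (Fin.last (d + 1))| := by gcongr
    _ = (1 + N) * |ξ (Fin.last (d + 1))| + |ξ 0| * |ξ (Fin.last (d + 1))| := by ring
    _ ≤ (1 + N) * N + (m ^ 2 + 1) * (1 + N ^ 2) := by gcongr
    _ ≤ _ := by nlinarith [mul_nonneg (sq_nonneg m) hN]

/-- `G ↦ a · (G ∘ spatial)` as a linear map. -/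
def mulSpatial {d : ℕ} (a : Euc (d + 2) → ℂ) : 𝓢(Euc (d + 1), ℂ) →ₗ[ℂ] (Euc (d + 2) → ℂ) where
  toFun G ξ := a ξ * G (spatial (d + 1) ξ)
  map_add' G H := by
    funext ξ
    simp [mul_add]
  map_smul' c G := by
    funext ξ
    simp [mul_left_comm]

lemma mulSpatial_hasFDerivAt {d : ℕ} {a : Euc (d + 2) → ℂ} (ha : a.HasTemperateGrowth)
    (G : 𝓢(Euc (d + 1), ℂ)) (ξ : Euc (d + 2)) {c : Fin (d + 2) → ℂ}
    (h0 : c 0 = mulSpatial (fun ξ => fderiv ℝ a ξ (e 0)) G ξ)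
    (hsucc : ∀ i : Fin (d + 1), c i.succ = mulSpatial (fun ξ => fderiv ℝ a ξ (e i.succ)) G ξ +
      mulSpatial a (∂_{e i} G) ξ) :
    HasFDerivAt (mulSpatial a G) (covector c) ξ := by
  have h1 := ((ha.1.differentiable (by simp)) ξ).hasFDerivAt.mul
    ((G.hasFDerivAt (spatial (d + 1) ξ)).comp ξ (spatial (d + 1)).hasFDerivAt)
  refine HasFDerivAt.covector h1 fun j => ?_
  refine Fin.cases ?_ (fun i => ?_) j
  · rw [h0, add_apply, smul_apply, smul_apply, ContinuousLinearMap.comp_apply, spatial_e_zero,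
      map_zero, smul_zero, zero_add]
    exact mul_comm _ _
  · have : spatial (d + 1) (e i.succ) = e i := by
      rw [← zeroPlus_e, spatial_zeroPlus]
    rw [hsucc, add_apply, smul_apply, smul_apply, ContinuousLinearMap.comp_apply, this, add_comm]
    congr 1
    exact mul_comm _ _

/-- Derivatives either hit the cutoff, giving another cutoff, or the flat function, giving another
flat function; so the family is closed under partial derivatives. -/
lemma exists_mulSpatial_lift {d : ℕ} {m : ℝ} (hm : 0 < m) {a : Euc (d + 2) → ℂ}
    (ha : IsShellCutoff m a) : ∃ T : hatTame d →L[ℂ] 𝓢(Euc (d + 2), ℂ),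
      ∀ (G : hatTame d) ξ, T G ξ = a ξ * (G : 𝓢(Euc (d + 1), ℂ)) (spatial (d + 1) ξ) := by
  refine exists_schwartz_lift (A := (mulSpatial a).comp (hatTame d).subtypeL.toLinearMap)
    (𝒢 := {A | ∃ a : Euc (d + 2) → ℂ, IsShellCutoff m a ∧
      ∃ D : hatTame d →L[ℂ] 𝓢(Euc (d + 1), ℂ), (∀ G, D G ∈ hatTame d) ∧
        A = (mulSpatial a).comp D.toLinearMap}) ?_ ?_ ⟨a, ha, _, fun G => G.2, rfl⟩
  · rintro _ ⟨a, ha, D, hD, rfl⟩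
    refine ⟨Fin.cases ((mulSpatial fun ξ => fderiv ℝ a ξ (e 0)).comp D.toLinearMap) fun i =>
      (mulSpatial fun ξ => fderiv ℝ a ξ (e i.succ)).comp D.toLinearMap +
      (mulSpatial a).comp
        ((LineDeriv.lineDerivOpCLM ℂ 𝓢(Euc (d + 1), ℂ) (e i)).comp D).toLinearMap,
      fun j => ?_, fun G ξ => mulSpatial_hasFDerivAt ha.1 (D G) ξ rfl fun i => rfl⟩
    refine Fin.cases ?_ (fun i => ?_) j
    · exact AddSubmonoid.subset_closure ⟨_, ha.fderiv_apply _, D, hD, rfl⟩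
    · exact add_mem (AddSubmonoid.subset_closure ⟨_, ha.fderiv_apply _, D, hD, rfl⟩)
        (AddSubmonoid.subset_closure ⟨_, ha, _, fun G => lineDerivOp_mem_hatTame (hD G) _, rfl⟩)
  · rintro _ ⟨a, ha, D, hD, rfl⟩ M
    obtain ⟨N, C, hC⟩ := ha.1.2 0
    have hC0 : 0 ≤ C := by
      have := (norm_nonneg _).trans (hC 0)
      simpa using this
    -- M powers of 1 + |ξ| come from the desired decay and N from the growth of a. Each costs one
    -- power of 1/|ξ⁻| and two powers of 1 + |(ξ_⊥, ξ⁻)|.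
    obtain ⟨q, hq, hqb⟩ := exists_flat_seminorm d (2 * (M + N)) (M + N)
    refine ⟨Real.toNNReal (C * (m ^ 2 + 2) ^ (M + N)) • q.comp D.toLinearMap,
      (hq.comp D.continuous).const_smul _, fun G ξ => ?_⟩
    rw [smul_apply, NNReal.smul_def, Real.coe_toNNReal _ (by positivity)]
    change ‖ξ‖ ^ M * ‖a ξ * D G (spatial (d + 1) ξ)‖ ≤ (C * (m ^ 2 + 2) ^ (M + N)) * q (D G)
    by_cases hξ : |kgSymbol m ξ| ≤ m ^ 2 / 2
    · have hlast := abs_pos.2 (last_ne_zero_of_abs_kgSymbol_le hm hξ)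
      have h1 := hqb (D G) (hD G) (spatial (d + 1) ξ)
      rw [spatial_apply, Fin.succ_last, pow_mul] at h1
      have h2 := pow_le_pow_left₀ (by positivity) (one_add_norm_mul_last_le hξ) (M + N)
      have h3 := hC ξ
      rw [norm_iteratedFDeriv_zero] at h3
      refine le_of_mul_le_mul_left ?_ (pow_pos hlast (M + N))
      calc |ξ (Fin.last (d + 1))| ^ (M + N) * (‖ξ‖ ^ M * ‖a ξ * D G (spatial (d + 1) ξ)‖)
          ≤ |ξ (Fin.last (d + 1))| ^ (M + N) * ((1 + ‖ξ‖) ^ M *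
              ((C * (1 + ‖ξ‖) ^ N) * ‖D G (spatial (d + 1) ξ)‖)) := by
            rw [norm_mul]
            gcongr
            linarith
        _ = C * (((1 + ‖ξ‖) * |ξ (Fin.last (d + 1))|) ^ (M + N) *
              ‖D G (spatial (d + 1) ξ)‖) := by
            rw [mul_pow, pow_add (1 + ‖ξ‖)]
            ring
        _ ≤ C * (((m ^ 2 + 2) * (1 + ‖spatial (d + 1) ξ‖) ^ 2) ^ (M + N) *
              ‖D G (spatial (d + 1) ξ)‖) := by gcongr
        _ = C * (m ^ 2 + 2) ^ (M + N) * (((1 + ‖spatial (d + 1) ξ‖) ^ 2) ^ (M + N) *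
              ‖D G (spatial (d + 1) ξ)‖) := by
            rw [mul_pow]
            ring
        _ ≤ C * (m ^ 2 + 2) ^ (M + N) * (|ξ (Fin.last (d + 1))| ^ (M + N) * q (D G)) := by
            gcongr
        _ = _ := by ring
    · rw [ha.2 ξ (not_le.1 hξ), zero_mul, norm_zero, mul_zero]
      positivity

lemma exists_isShellCutoff (d : ℕ) {m : ℝ} (hm : 0 < m) : ∃ a : Euc (d + 2) → ℂ,
    IsShellCutoff m a ∧ ∀ ξ, kgSymbol m ξ = 0 → a ξ = 1 := by
  have hm2 : 0 < m ^ 2 := by positivity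
  let θ : ContDiffBump (0 : ℝ) := ⟨m ^ 2 / 8, m ^ 2 / 4, by positivity, by linarith⟩
  refine ⟨fun ξ => ((θ (kgSymbol m ξ) : ℝ) : ℂ), ⟨?_, fun ξ hξ => ?_⟩, fun ξ hξ => ?_⟩
  · exact Function.Complex.hasTemperateGrowth_ofReal.comp
      ((θ.hasCompactSupport.hasTemperateGrowth θ.contDiff).comp (hasTemperateGrowth_kgSymbol m))
  · beta_reduce
    rw [θ.zero_of_le_dist, Complex.ofReal_zero]
    rw [Real.dist_eq, sub_zero]
    change m ^ 2 / 4 ≤ _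
    linarith
  · beta_reduce
    rw [hξ, θ.one_of_mem_closedBall (by simpa using θ.rIn_pos.le), Complex.ofReal_one]

lemma exists_shellExtension (d : ℕ) {m : ℝ} (hm : 0 < m) :
    ∃ T : hatTame d →L[ℂ] 𝓢(Euc (d + 2), ℂ), ∀ G : hatTame d,
      shellRestriction hm (T G) = (G : 𝓢(Euc (d + 1), ℂ)) := by
  obtain ⟨a, ha, ha1⟩ := exists_isShellCutoff d hm
  obtain ⟨T, hT⟩ := exists_mulSpatial_lift hm ha
  refine ⟨T, fun G => ?_⟩
  ext η
  by_cases h : η (Fin.last d) = 0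
  · rw [shellRestriction_of_eq hm _ h, hatTame_apply_eq_zero G.2 h]
  · rw [shellRestriction_of_ne hm _ h, hT, spatial_shellPoint, ha1 _ (kgSymbol_shellPoint m h),
      one_mul]

/-- A continuous linear right inverse of the restriction to the mass shell. -/
def shellExtension {d : ℕ} {m : ℝ} (hm : 0 < m) : hatTame d →L[ℂ] 𝓢(Euc (d + 2), ℂ) :=
  (exists_shellExtension d hm).choose

lemma shellRestriction_shellExtension {d : ℕ} {m : ℝ} (hm : 0 < m) (G : hatTame d) :
    shellRestriction hm (shellExtension hm G) = (G : 𝓢(Euc (d + 1), ℂ)) :=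
  (exists_shellExtension d hm).choose_spec G

/-! ### Division by the symbol of the Klein-Gordon operator -/

/-- The integral is a convolution with the indicator of (0, 1], evaluated at 0, so smoothness of
convolutions with parameters applies. The bump equals 1 on [−1, 1] and only supplies compact
support. -/
lemma contDiff_integral_zero_one {P : Type*} [NormedAddCommGroup P] [NormedSpace ℝ P]
    {F : P → ℝ → ℂ} (hF : ContDiff ℝ ∞ (Function.uncurry F)) :
    ContDiff ℝ ∞ fun p => ∫ s in (0 : ℝ)..1, F p s := by
  let χ : ContDiffBump (0 : ℝ) := ⟨1, 2, one_pos, one_lt_two⟩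
  have hneg : ContDiff ℝ ∞ fun y : P × ℝ => (y.1, -y.2) := contDiff_fst.prodMk contDiff_snd.neg
  have h := MeasureTheory.contDiffOn_convolution_right_with_param_comp (n := ⊤) (μ := MeasureTheory.volume)
    (f := (Set.Ioc (0 : ℝ) 1).indicator fun _ => (1 : ℝ)) (ContinuousLinearMap.lsmul ℝ ℝ)
    (g := fun (p : P) (z : ℝ) => χ (-z) • F p (-z)) (s := Set.univ)
    (k := Metric.closedBall 0 2) (v := fun _ => (0 : ℝ))
    contDiffOn_const isOpen_univ (isCompact_closedBall _ _)
    (fun p z _ hz => by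
      rw [χ.zero_of_le_dist, zero_smul]
      have : (2 : ℝ) < dist z 0 := by simpa using hz
      rw [dist_zero_right, norm_neg]
      rw [dist_zero_right] at this
      exact this.le)
    ((MeasureTheory.integrable_indicator_iff measurableSet_Ioc).2
      (MeasureTheory.integrableOn_const (by simp))).locallyIntegrable
    (ContDiff.contDiffOn ((χ.contDiff.comp contDiff_snd.neg).smul (hF.comp hneg)))
  rw [contDiffOn_univ] at h
  refine (congrArg (ContDiff ℝ ∞) (funext fun p => ?_)).mp h
  rw [MeasureTheory.convolution_def, intervalIntegral.integral_of_le zero_le_one,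
    ← MeasureTheory.integral_indicator measurableSet_Ioc]
  refine MeasureTheory.integral_congr_ae (Filter.Eventually.of_forall fun t => ?_)
  by_cases ht : t ∈ Set.Ioc (0 : ℝ) 1
  · simp only [Set.indicator_of_mem ht, zero_sub, neg_neg, ContinuousLinearMap.lsmul_apply,
      one_smul]
    rw [χ.one_of_mem_closedBall, one_smul]
    rw [Metric.mem_closedBall, dist_zero_right, Real.norm_eq_abs, abs_of_pos ht.1]
    exact ht.2
  · simp only [Set.indicator_of_notMem ht, map_zero, zero_apply]

lemma kgSymbol_add_smul {d : ℕ} (m τ : ℝ) (ξ : Euc (d + 2)) :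
    kgSymbol m (ξ + τ • e 0) = kgSymbol m ξ - 8 * Real.pi ^ 2 * ξ (Fin.last (d + 1)) * τ := by
  rw [kgSymbol, kgSymbol, map_add, map_smul, spatial_e_zero, smul_zero, add_zero]
  simp [Fin.last_pos.ne']
  ring

open Classical in
/-- The quotient of `Φ` by the symbol of the Klein-Gordon operator, extended to the mass shell by
its limit if `Φ` vanishes there. -/
def shellQuotient {d : ℕ} (m : ℝ) (Φ : 𝓢(Euc (d + 2), ℂ)) (ξ : Euc (d + 2)) : ℂ :=
  if kgSymbol m ξ = 0 then -((8 * Real.pi ^ 2 * ξ (Fin.last (d + 1)) : ℝ) : ℂ)⁻¹ *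
    (∂_{e (0 : Fin (d + 2))} Φ) ξ
  else ((kgSymbol m ξ : ℝ) : ℂ)⁻¹ * Φ ξ

lemma kgSymbol_mul_shellQuotient {d : ℕ} {m : ℝ} {Φ : 𝓢(Euc (d + 2), ℂ)}
    (hΦ : ∀ ξ, kgSymbol m ξ = 0 → Φ ξ = 0) (ξ : Euc (d + 2)) :
    Φ ξ = ((kgSymbol m ξ : ℝ) : ℂ) * shellQuotient m Φ ξ := by
  by_cases h : kgSymbol m ξ = 0
  · rw [hΦ ξ h, h, Complex.ofReal_zero, zero_mul]
  · rw [shellQuotient, if_neg h, mul_inv_cancel_left₀ (Complex.ofReal_ne_zero.2 h)]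

/-- Hadamard's lemma in the ξ⁺ direction: the symbol is affine in ξ⁺ with slope −8π²ξ⁻, so shifting
ξ⁺ by p(ξ)/(8π²ξ⁻) lands on the shell, where Φ vanishes. -/
lemma shellQuotient_eq_integral {d : ℕ} {m : ℝ} {Φ : 𝓢(Euc (d + 2), ℂ)}
    (hΦ : ∀ ξ, kgSymbol m ξ = 0 → Φ ξ = 0) {ξ : Euc (d + 2)}
    (hξ : ξ (Fin.last (d + 1)) ≠ 0) :
    shellQuotient m Φ ξ = -((8 * Real.pi ^ 2 * ξ (Fin.last (d + 1)) : ℝ) : ℂ)⁻¹ *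
      ∫ s in (0 : ℝ)..1, (∂_{e (0 : Fin (d + 2))} Φ)
        (ξ + s • (kgSymbol m ξ / (8 * Real.pi ^ 2 * ξ (Fin.last (d + 1)))) •
          e (0 : Fin (d + 2))) := by
  have hc : 8 * Real.pi ^ 2 * ξ (Fin.last (d + 1)) ≠ 0 := by
    have := Real.pi_ne_zero
    positivity
  set c := 8 * Real.pi ^ 2 * ξ (Fin.last (d + 1))
  by_cases h : kgSymbol m ξ = 0
  · simp [shellQuotient, h, c]
  · have hd : ∀ s : ℝ, HasDerivAt
        (fun s : ℝ => Φ (ξ + s • (kgSymbol m ξ / c) • e (0 : Fin (d + 2))))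
        (((kgSymbol m ξ / c : ℝ) : ℂ) * (∂_{e (0 : Fin (d + 2))} Φ)
          (ξ + s • (kgSymbol m ξ / c) • e (0 : Fin (d + 2)))) s := by
      intro s
      have h1 : HasDerivAt (fun s : ℝ => ξ + s • (kgSymbol m ξ / c) • e (0 : Fin (d + 2)))
          ((kgSymbol m ξ / c) • e (0 : Fin (d + 2))) s := by
        simpa using ((hasDerivAt_id s).smul_const
          ((kgSymbol m ξ / c) • e (0 : Fin (d + 2)))).const_add ξ
      refine ((Φ.hasFDerivAt _).comp_hasDerivAt s h1).congr_deriv ?_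
      rw [map_smul, SchwartzMap.lineDerivOp_apply_eq_fderiv, Complex.real_smul]
    have h2 := intervalIntegral.integral_eq_sub_of_hasDerivAt (a := 0) (b := 1)
      (fun s _ => hd s) ((continuous_const.mul
        ((∂_{e (0 : Fin (d + 2))} Φ).continuous.comp (by fun_prop))).intervalIntegrable _ _)
    have h3 : Φ (ξ + (1 : ℝ) • (kgSymbol m ξ / c) • e (0 : Fin (d + 2))) = 0 := by
      apply hΦ
      rw [one_smul, kgSymbol_add_smul]
      change kgSymbol m ξ - c * (kgSymbol m ξ / c) = 0
      field_simp
      ring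
    rw [h3, zero_smul, add_zero, zero_sub, intervalIntegral.integral_const_mul] at h2
    have hp : ((kgSymbol m ξ : ℝ) : ℂ) ≠ 0 := Complex.ofReal_ne_zero.2 h
    have hc' : (c : ℂ) ≠ 0 := Complex.ofReal_ne_zero.2 hc
    rw [shellQuotient, if_neg h]
    rw [Complex.ofReal_div] at h2
    rw [← neg_eq_iff_eq_neg.2 h2]
    field_simp

lemma contDiff_shellQuotient {d : ℕ} {m : ℝ} (hm : 0 < m) {Φ : 𝓢(Euc (d + 2), ℂ)}
    (hΦ : ∀ ξ, kgSymbol m ξ = 0 → Φ ξ = 0) : ContDiff ℝ ∞ (shellQuotient m Φ) := by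
  have hp : ContDiff ℝ ∞ (kgSymbol m : Euc (d + 2) → ℝ) := (hasTemperateGrowth_kgSymbol m).1
  rw [contDiff_iff_contDiffAt]
  intro ξ
  by_cases h : kgSymbol m ξ = 0
  · have hξ : ξ (Fin.last (d + 1)) ≠ 0 := by
      refine last_ne_zero_of_abs_kgSymbol_le hm ?_
      rw [h, abs_zero]
      positivity
    have hopen : IsOpen {ξ : Euc (d + 2) | ξ (Fin.last (d + 1)) ≠ 0} :=
      isOpen_ne_fun (by fun_prop) continuous_const
    have hev : shellQuotient m Φ =ᶠ[nhds ξ] fun ξ =>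
        -((8 * Real.pi ^ 2 * ξ (Fin.last (d + 1)) : ℝ) : ℂ)⁻¹ *
        ∫ s in (0 : ℝ)..1, (∂_{e (0 : Fin (d + 2))} Φ)
          (ξ + s • (kgSymbol m ξ / (8 * Real.pi ^ 2 * ξ (Fin.last (d + 1)))) •
            e (0 : Fin (d + 2))) := by
      filter_upwards [hopen.mem_nhds hξ] with ξ' hξ'
      exact shellQuotient_eq_integral hΦ hξ'
    refine ContDiffAt.congr_of_eventuallyEq ?_ hev
    have hK := contDiff_integral_zero_one (P := Euc (d + 2) × ℝ)
      (F := fun y s => (∂_{e (0 : Fin (d + 2))} Φ) (y.1 + s • y.2 • e (0 : Fin (d + 2))))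
      (((∂_{e (0 : Fin (d + 2))} Φ).smooth ⊤).comp (by fun_prop))
    have hl : ContDiff ℝ ∞ fun ξ : Euc (d + 2) => 8 * Real.pi ^ 2 * ξ (Fin.last (d + 1)) :=
      contDiff_const.mul (EuclideanSpace.proj (Fin.last (d + 1)) : Euc (d + 2) →L[ℝ] ℝ).contDiff
    have hne : 8 * Real.pi ^ 2 * ξ (Fin.last (d + 1)) ≠ 0 := by
      have := Real.pi_ne_zero
      positivity
    have hr : ContDiffAt ℝ ∞ (fun ξ : Euc (d + 2) =>
        (ξ, kgSymbol m ξ / (8 * Real.pi ^ 2 * ξ (Fin.last (d + 1))))) ξ :=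
      contDiffAt_id.prodMk (hp.contDiffAt.div hl.contDiffAt hne)
    refine ContDiffAt.mul ?_ (hK.contDiffAt.comp ξ hr)
    exact ((Complex.ofRealCLM.contDiff.comp hl).contDiffAt.inv
      (Complex.ofReal_ne_zero.2 hne)).neg
  · have hev : shellQuotient m Φ =ᶠ[nhds ξ] fun ξ => ((kgSymbol m ξ : ℝ) : ℂ)⁻¹ * Φ ξ := by
      have hopen : IsOpen {ξ : Euc (d + 2) | kgSymbol m ξ ≠ 0} :=
        isOpen_ne_fun hp.continuous continuous_const
      filter_upwards [hopen.mem_nhds h] with ξ' hξ'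
      exact if_neg hξ'
    refine ContDiffAt.congr_of_eventuallyEq ?_ hev
    exact ((Complex.ofRealCLM.contDiff.comp hp).contDiffAt.inv
      (Complex.ofReal_ne_zero.2 h)).mul (Φ.smooth ⊤).contDiffAt

/-- Smooth functions which become Schwartz functions after multiplication by a power of the symbol
of the Klein-Gordon operator. -/
def IsShellQuotient {d : ℕ} (m : ℝ) (G : Euc (d + 2) → ℂ) : Prop :=
  ContDiff ℝ ∞ G ∧ ∃ (k : ℕ) (Φ : 𝓢(Euc (d + 2), ℂ)),
    ∀ ξ, Φ ξ = ((kgSymbol m ξ : ℝ) : ℂ) ^ k * G ξ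

lemma hasTemperateGrowth_kgSymbol_complex {d : ℕ} (m : ℝ) :
    Function.HasTemperateGrowth fun ξ : Euc (d + 2) => ((kgSymbol m ξ : ℝ) : ℂ) :=
  Function.Complex.hasTemperateGrowth_ofReal.comp (hasTemperateGrowth_kgSymbol m)

/-- With p the symbol and Φ = pᵏG, one has p^{k+1} ∂G = p ∂Φ − k (∂p) Φ, which is Schwartz. Letting
k vary makes the class stable under differentiation. -/
lemma IsShellQuotient.fderiv_apply {d : ℕ} {m : ℝ} {G : Euc (d + 2) → ℂ}
    (hG : IsShellQuotient m G) (v : Euc (d + 2)) :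
    IsShellQuotient m fun ξ => fderiv ℝ G ξ v := by
  obtain ⟨hs, k, Φ, hΦ⟩ := hG
  have hp := hasTemperateGrowth_kgSymbol_complex (d := d) m
  have hp' := HasTemperateGrowth.fderiv_apply hp v
  refine ⟨(contDiff_infty_iff_fderiv.1 hs).2.clm_apply contDiff_const, k + 1,
    SchwartzMap.smulLeftCLM ℂ (fun ξ : Euc (d + 2) => ((kgSymbol m ξ : ℝ) : ℂ)) (∂_{v} Φ) -
      (k : ℂ) • SchwartzMap.smulLeftCLM ℂ (fun ξ : Euc (d + 2) =>
        fderiv ℝ (fun ξ => ((kgSymbol m ξ : ℝ) : ℂ)) ξ v) Φ, fun ξ => ?_⟩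
  have h1 := (((hp.1.differentiable (by simp)) ξ).hasFDerivAt.pow k).mul
    ((hs.differentiable (by simp)) ξ).hasFDerivAt
  have h2 : HasFDerivAt Φ _ ξ := h1.congr_of_eventuallyEq (Filter.Eventually.of_forall hΦ)
  rw [sub_apply, smul_apply, SchwartzMap.smulLeftCLM_apply_apply hp,
    SchwartzMap.smulLeftCLM_apply_apply hp', SchwartzMap.lineDerivOp_apply_eq_fderiv, h2.fderiv,
    hΦ ξ, add_apply, smul_apply, smul_apply, smul_apply]
  cases k with
  | zero => simp
  | succ k =>
    simp
    ring

/-- Away from the shell one divides by |p|ᵏ. Near it the division estimate in ξ⁺ bounds |8π²ξ⁻|ᵏ|G|,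
and |8π²ξ⁻|(1 + |ξ|) ≥ m²/2 removes the small factor at the cost of k extra weights. -/
lemma IsShellQuotient.exists_bound {d : ℕ} {m : ℝ} (hm : 0 < m) {G : Euc (d + 2) → ℂ}
    (hG : IsShellQuotient m G) (M : ℕ) : ∃ B, 0 ≤ B ∧ ∀ ξ, ‖ξ‖ ^ M * ‖G ξ‖ ≤ B := by
  obtain ⟨hs, k, Φ, hΦ⟩ := hG
  have hm2 : 0 < m ^ 2 / 2 := by positivity
  obtain ⟨q, -, hq⟩ := exists_weight_seminorm (d + 2) M
  let P := SchwartzMap.smulLeftCLM ℂ (weight (M + k) : Euc (d + 2) → ℂ)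
  have hP : ∀ (F : 𝓢(Euc (d + 2), ℂ)) x, P F x = weight (M + k) x * F x := fun F x => by
    rw [SchwartzMap.smulLeftCLM_apply_apply (hasTemperateGrowth_weight _), smul_eq_mul]
  set S := SchwartzMap.seminorm ℂ 0 0 (iterDeriv (e 0) k (P Φ))
  refine ⟨(q Φ + 2 ^ (M + k) * S) / (m ^ 2 / 2) ^ k, by positivity, fun ξ => ?_⟩
  rw [le_div_iff₀ (by positivity)]
  by_cases h : |kgSymbol m ξ| ≤ m ^ 2 / 2
  · have hlast := last_ne_zero_of_abs_kgSymbol_le hm h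
    have hpi := Real.pi_ne_zero
    have h1 := norm_le_seminorm_iterDeriv (Φ := P Φ) (x := ξ) (v := e 0) (n := k)
      (a := kgSymbol m ξ / (8 * Real.pi ^ 2 * ξ (Fin.last (d + 1))))
      (g := fun τ => ((-(8 * Real.pi ^ 2 * ξ (Fin.last (d + 1))) : ℝ) : ℂ) ^ k *
        (weight (M + k) (ξ + τ • e 0) * G (ξ + τ • e 0)))
      (contDiff_const.mul (((hasTemperateGrowth_weight _).1.comp (by fun_prop)).mul
        (hs.comp (by fun_prop)))) (fun τ => by
          rw [hP, hΦ, kgSymbol_add_smul, ← mul_assoc (_ ^ k), ← mul_pow, ← Complex.ofReal_mul,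
            mul_left_comm]
          congr 4
          field_simp
          ring)
    simp only [zero_smul, add_zero, norm_mul, norm_pow, Complex.norm_real, Real.norm_eq_abs,
      abs_neg] at h1
    have h2 : m ^ 2 / 2 ≤ |8 * Real.pi ^ 2 * ξ (Fin.last (d + 1))| * (1 + ‖ξ‖) := by
      have h3 : m ^ 2 / 2 ≤ (8 * Real.pi ^ 2 * ξ (Fin.last (d + 1))) * ξ 0 := by
        have h4 := sq_le_perpSymbol m (spatial (d + 1) ξ)
        have h5 := (abs_le.1 h).2
        unfold kgSymbol at h5
        linarith
      have h6 : |ξ 0| ≤ ‖ξ‖ := PiLp.norm_apply_le ξ 0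
      calc m ^ 2 / 2 ≤ |(8 * Real.pi ^ 2 * ξ (Fin.last (d + 1))) * ξ 0| :=
            h3.trans (le_abs_self _)
        _ = |8 * Real.pi ^ 2 * ξ (Fin.last (d + 1))| * |ξ 0| := abs_mul _ _
        _ ≤ _ := by
          gcongr
          linarith
    calc ‖ξ‖ ^ M * ‖G ξ‖ * (m ^ 2 / 2) ^ k
        ≤ (1 + ‖ξ‖) ^ M * ‖G ξ‖ *
            (|8 * Real.pi ^ 2 * ξ (Fin.last (d + 1))| * (1 + ‖ξ‖)) ^ k := by
          gcongr
          linarith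
      _ = |8 * Real.pi ^ 2 * ξ (Fin.last (d + 1))| ^ k * ((1 + ‖ξ‖) ^ (M + k) * ‖G ξ‖) := by
          rw [mul_pow, pow_add]
          ring
      _ ≤ |8 * Real.pi ^ 2 * ξ (Fin.last (d + 1))| ^ k *
            ((2 ^ (M + k) * ‖weight (M + k) ξ‖) * ‖G ξ‖) := by
          gcongr
          exact weight_le _ _
      _ = 2 ^ (M + k) * (|8 * Real.pi ^ 2 * ξ (Fin.last (d + 1))| ^ k *
            (‖weight (M + k) ξ‖ * ‖G ξ‖)) := by ring
      _ ≤ 2 ^ (M + k) * S := by gcongr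
      _ ≤ _ := le_add_of_nonneg_left (apply_nonneg _ _)
  · have h1 := hq Φ ξ
    rw [hΦ, norm_mul, norm_pow, Complex.norm_real, Real.norm_eq_abs] at h1
    calc ‖ξ‖ ^ M * ‖G ξ‖ * (m ^ 2 / 2) ^ k ≤
        (1 + ‖ξ‖) ^ M * ‖G ξ‖ * |kgSymbol m ξ| ^ k := by
          gcongr
          · linarith
          · exact (not_le.1 h).le
      _ = (1 + ‖ξ‖) ^ M * (|kgSymbol m ξ| ^ k * ‖G ξ‖) := by ring
      _ ≤ q Φ := h1
      _ ≤ _ := le_add_of_nonneg_right (by positivity)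

/-- A Schwartz function which vanishes on the mass shell is divisible by the symbol of the
Klein-Gordon operator. -/
theorem exists_eq_kgSymbol_mul {d : ℕ} {m : ℝ} (hm : 0 < m) {Φ : 𝓢(Euc (d + 2), ℂ)}
    (hΦ : ∀ ξ, kgSymbol m ξ = 0 → Φ ξ = 0) : ∃ G : 𝓢(Euc (d + 2), ℂ),
      ∀ ξ, Φ ξ = ((kgSymbol m ξ : ℝ) : ℂ) * G ξ := by
  have h0 : IsShellQuotient m (shellQuotient m Φ) :=
    ⟨contDiff_shellQuotient hm hΦ, 1, Φ, fun ξ => by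
      rw [pow_one]
      exact kgSymbol_mul_shellQuotient hΦ ξ⟩
  -- A single function is treated as the linear map c ↦ c · G on the scalars, and recovered at c =
  -- 1.
  obtain ⟨T, hT⟩ := exists_schwartz_lift (W := ℂ)
    (A := LinearMap.toSpanSingleton ℂ (Euc (d + 2) → ℂ) (shellQuotient m Φ))
    (𝒢 := {A | ∃ G : Euc (d + 2) → ℂ, IsShellQuotient m G ∧
      A = LinearMap.toSpanSingleton ℂ (Euc (d + 2) → ℂ) G}) (by
      rintro _ ⟨G, hG, rfl⟩
      refine ⟨fun j => LinearMap.toSpanSingleton ℂ (Euc (d + 2) → ℂ) fun ξ => fderiv ℝ G ξ (e j),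
        fun j => AddSubmonoid.subset_closure ⟨_, hG.fderiv_apply _, rfl⟩, fun c ξ => ?_⟩
      exact HasFDerivAt.covector
        (((hG.1.differentiable (by simp)) ξ).hasFDerivAt.const_smul c) fun j => rfl) (by
      rintro _ ⟨G, hG, rfl⟩ M
      obtain ⟨B, hB, hb⟩ := hG.exists_bound hm M
      refine ⟨Real.toNNReal B • normSeminorm ℂ ℂ, continuous_norm.const_smul _, fun c ξ => ?_⟩
      rw [smul_apply, NNReal.smul_def, Real.coe_toNNReal _ hB, coe_normSeminorm]
      simp only [LinearMap.toSpanSingleton_apply, Pi.smul_apply, smul_eq_mul, norm_mul]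
      rw [mul_left_comm, mul_comm B]
      exact mul_le_mul_of_nonneg_left (hb ξ) (norm_nonneg c)) ⟨_, h0, rfl⟩
  refine ⟨T 1, fun ξ => ?_⟩
  rw [hT, LinearMap.toSpanSingleton_apply, one_smul]
  exact kgSymbol_mul_shellQuotient hΦ ξ

open FourierTransform MeasureTheory

/-! ### The Klein-Gordon operator on test functions -/

lemma eq_of_fourier_apply_eq {k : ℕ} {φ ψ : 𝓢(Euc k, ℂ)} (h : ∀ ξ, 𝓕 φ ξ = 𝓕 ψ ξ) : φ = ψ := by
  have h1 : 𝓕⁻ (𝓕 φ) = 𝓕⁻ (𝓕 ψ) := congrArg _ (SchwartzMap.ext h)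
  simpa only [fourierInv_fourier_eq] using h1

lemma fourier_lineDerivOp_e {k : ℕ} (i : Fin k) (φ : 𝓢(Euc k, ℂ)) (ξ : Euc k) :
    𝓕 (∂_{e i} φ) ξ = 2 * Real.pi * Complex.I * ((ξ i : ℝ) : ℂ) * 𝓕 φ ξ := by
  have h : (fun x : Euc k => inner ℝ x (e i)).HasTemperateGrowth := by fun_prop
  rw [SchwartzMap.fourier_lineDerivOp_eq, smul_apply, SchwartzMap.smulLeftCLM_apply_apply h]
  simp [EuclideanSpace.inner_single_right, mul_assoc]

/-- The Klein-Gordon operator `2 ∂₊ ∂₋ - ∑ ∂ᵢ² + m²` on Schwartz functions. -/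
def kgOp {d : ℕ} (m : ℝ) (φ : 𝓢(Euc (d + 2), ℂ)) : 𝓢(Euc (d + 2), ℂ) :=
  (2 : ℂ) • ∂_{e (Fin.last (d + 1))} (∂_{e (0 : Fin (d + 2))} φ)
    - ∑ i : Fin d, ∂_{e i.castSucc.succ} (∂_{e i.castSucc.succ} φ) + ((m : ℂ) ^ 2) • φ

lemma fourier_kgOp {d : ℕ} (m : ℝ) (φ : 𝓢(Euc (d + 2), ℂ)) (ξ : Euc (d + 2)) :
    𝓕 (kgOp m φ) ξ = ((kgSymbol m ξ : ℝ) : ℂ) * 𝓕 φ ξ := by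
  have hI : Complex.I ^ 2 = -1 := Complex.I_sq
  rw [kgOp, ← fourierCLM_apply (R := ℂ), map_add, map_sub, map_sum, map_smul, map_smul]
  simp only [fourierCLM_apply, add_apply, sub_apply, smul_apply, sum_apply, fourier_lineDerivOp_e,
    smul_eq_mul]
  rw [kgSymbol, perpSymbol, EuclideanSpace.norm_sq_eq]
  simp only [perp_apply, spatial_apply, Real.norm_eq_abs, sq_abs]
  push_cast
  rw [Finset.mul_sum, sub_mul, add_mul, Finset.sum_mul, ← sub_eq_zero]
  have hs : ∀ i : Fin d, (2 * Real.pi * Complex.I * ((ξ i.castSucc.succ : ℝ) : ℂ) *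
      (2 * Real.pi * Complex.I * ((ξ i.castSucc.succ : ℝ) : ℂ) * 𝓕 φ ξ)) =
      -(4 * (Real.pi : ℂ) ^ 2 * ((ξ i.castSucc.succ : ℝ) : ℂ) ^ 2 * 𝓕 φ ξ) := fun i => by
    linear_combination (4 * (Real.pi : ℂ) ^ 2 * ((ξ i.castSucc.succ : ℝ) : ℂ) ^ 2 * 𝓕 φ ξ) * hI
  simp only [hs, Finset.sum_neg_distrib]
  linear_combination (8 * (Real.pi : ℂ) ^ 2 * (ξ 0 : ℂ) * (ξ (Fin.last (d + 1)) : ℂ) * 𝓕 φ ξ) * hI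

/-- All derivatives come in pairs, so the signs cancel. Transposition reverses their order, which is
why `kgOp` has ∂₋∂₊. -/
lemma isLCKGSolution_iff {d : ℕ} {m : ℝ} {u : 𝓢'(Euc (d + 2), ℂ)} :
    IsLCKGSolution m u ↔ ∀ φ, u (kgOp m φ) = 0 := by
  have h : ∀ φ, (lcBox u + ((m : ℂ) ^ 2) • u) φ = u (kgOp m φ) := fun φ => by
    simp only [lcBox, kgOp, add_apply, sub_apply, smul_apply, sum_apply, map_add, map_sub, map_sum,
      map_smul, TemperedDistribution.lineDerivOp_apply_apply, map_neg, neg_neg]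
  rw [IsLCKGSolution, DFunLike.ext_iff]
  exact forall_congr' fun φ => by rw [h]; rfl

/-! ### The Fourier transform of tame test functions -/

lemma fourier_iterate_lineDerivOp_e {k : ℕ} (i : Fin k) (n : ℕ) (φ : 𝓢(Euc k, ℂ)) (ξ : Euc k) :
    𝓕 (∂_{e i}^[n] φ) ξ = (2 * Real.pi * Complex.I * ((ξ i : ℝ) : ℂ)) ^ n * 𝓕 φ ξ := by
  induction n with
  | zero => simp
  | succ n ih => rw [Function.iterate_succ_apply', fourier_lineDerivOp_e, ih]; ring

lemma mem_tameSchwartz_iff_fourier {k : ℕ} {g : 𝓢(Euc (k + 1), ℂ)} :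
    g ∈ tameSchwartz k ↔ 𝓕 g ∈ hatTame k := by
  have hpi : (2 * Real.pi * Complex.I : ℂ) ≠ 0 := Complex.two_pi_I_ne_zero
  rw [mem_tameSchwartz, mem_hatTame]
  refine forall_congr' fun n => ⟨?_, ?_⟩
  · rintro ⟨h, rfl⟩
    refine ⟨(2 * Real.pi * Complex.I : ℂ) ^ n • 𝓕 h, fun η => ?_⟩
    rw [LineDeriv.iteratedLineDerivOp_const_eq_iter_lineDerivOp, fourier_iterate_lineDerivOp_e,
      smul_apply, smul_eq_mul]
    ring
  · rintro ⟨H, hH⟩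
    refine ⟨𝓕⁻ (((2 * Real.pi * Complex.I : ℂ) ^ n)⁻¹ • H), ?_⟩
    refine eq_of_fourier_apply_eq fun η => ?_
    rw [LineDeriv.iteratedLineDerivOp_const_eq_iter_lineDerivOp, fourier_iterate_lineDerivOp_e,
      fourier_fourierInv_eq, smul_apply, smul_eq_mul, hH, mul_pow]
    field_simp

/-- The Fourier transform from `S_{∂₋}(ℝᵏ⁺¹)` to `hatTame`. -/
def fourierTame (k : ℕ) : tameSchwartz k →L[ℂ] hatTame k :=
  ((fourierCLM ℂ 𝓢(Euc (k + 1), ℂ)).comp (tameSchwartz k).subtypeL).codRestrict (hatTame k)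
    fun g => mem_tameSchwartz_iff_fourier.1 g.2

/-- The extension of a tame test function to a Schwartz function on `ℝ¹⁺ⁿ`, by extending its
Fourier transform from the mass shell. -/
def tameExtension {d : ℕ} {m : ℝ} (hm : 0 < m) : tameSchwartz d →L[ℂ] 𝓢(Euc (d + 2), ℂ) :=
  (fourierInvCLM ℂ 𝓢(Euc (d + 2), ℂ)).comp ((shellExtension hm).comp (fourierTame d))

/-- The tame test function whose Fourier transform is the restriction of that of a given Schwartz
function to the mass shell. -/
def tameRestriction {d : ℕ} {m : ℝ} (hm : 0 < m) : 𝓢(Euc (d + 2), ℂ) →L[ℂ] tameSchwartz d :=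
  ((fourierInvCLM ℂ 𝓢(Euc (d + 1), ℂ)).comp
    ((shellRestriction hm).comp (fourierCLM ℂ 𝓢(Euc (d + 2), ℂ)))).codRestrict (tameSchwartz d)
    fun φ => mem_tameSchwartz_iff_fourier.2 (by
      simpa using shellRestriction_mem_hatTame hm (𝓕 φ))

lemma coe_tameRestriction {d : ℕ} {m : ℝ} (hm : 0 < m) (φ : 𝓢(Euc (d + 2), ℂ)) :
    (tameRestriction hm φ : 𝓢(Euc (d + 1), ℂ)) = 𝓕⁻ (shellRestriction hm (𝓕 φ)) := rfl

lemma shellRestriction_fourier_tameExtension {d : ℕ} {m : ℝ} (hm : 0 < m) (g : tameSchwartz d) :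
    shellRestriction hm (𝓕 (tameExtension hm g)) = 𝓕 (g : 𝓢(Euc (d + 1), ℂ)) := by
  have h : 𝓕 (tameExtension hm g) = shellExtension hm (fourierTame d g) :=
    fourier_fourierInv_eq _
  rw [h, shellRestriction_shellExtension]
  rfl

lemma tameRestriction_tameExtension {d : ℕ} {m : ℝ} (hm : 0 < m) (g : tameSchwartz d) :
    tameRestriction hm (tameExtension hm g) = g := by
  ext1
  rw [coe_tameRestriction, shellRestriction_fourier_tameExtension, fourierInv_fourier_eq]

lemma tameRestriction_eq_of_fourier_eq {d : ℕ} {m : ℝ} (hm : 0 < m) {φ ψ : 𝓢(Euc (d + 2), ℂ)}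
    (h : ∀ η : Euc (d + 1), η (Fin.last d) ≠ 0 → 𝓕 φ (shellPoint m η) = 𝓕 ψ (shellPoint m η)) :
    tameRestriction hm φ = tameRestriction hm ψ := by
  ext1
  rw [coe_tameRestriction, coe_tameRestriction]
  congr 1
  ext η
  by_cases hη : η (Fin.last d) = 0
  · rw [shellRestriction_of_eq hm _ hη, shellRestriction_of_eq hm _ hη]
  · rw [shellRestriction_of_ne hm _ hη, shellRestriction_of_ne hm _ hη, h η hη]

lemma tameRestriction_kgOp {d : ℕ} {m : ℝ} (hm : 0 < m) (φ : 𝓢(Euc (d + 2), ℂ)) :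
    tameRestriction hm (kgOp m φ) = 0 := by
  rw [← map_zero (tameRestriction hm)]
  refine tameRestriction_eq_of_fourier_eq hm fun η hη => ?_
  rw [fourier_kgOp, kgSymbol_shellPoint m hη, ← fourierCLM_apply (R := ℂ) (0 : 𝓢(Euc (d + 2), ℂ)),
    map_zero]
  simp

/-- A Schwartz function with vanishing tame restriction is in the range of the Klein-Gordon
operator. -/
lemma exists_kgOp_eq {d : ℕ} {m : ℝ} (hm : 0 < m) {φ : 𝓢(Euc (d + 2), ℂ)}
    (hφ : tameRestriction hm φ = 0) : ∃ ψ, kgOp m ψ = φ := by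
  have h0 : shellRestriction hm (𝓕 φ) = 0 := by
    have h := congrArg (fun g : tameSchwartz d => 𝓕 (g : 𝓢(Euc (d + 1), ℂ))) hφ
    simp only [coe_tameRestriction, fourier_fourierInv_eq] at h
    rw [h, Submodule.coe_zero, ← fourierCLM_apply (R := ℂ), map_zero]
  obtain ⟨G, hG⟩ := exists_eq_kgSymbol_mul hm (Φ := 𝓕 φ) fun ξ hξ => by
    have hne : ξ (Fin.last (d + 1)) ≠ 0 :=
      last_ne_zero_of_abs_kgSymbol_le hm (by rw [hξ, abs_zero]; positivity)
    rw [← shellPoint_spatial_of_kgSymbol_eq_zero hne hξ,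
      ← shellRestriction_of_ne hm _ (by simpa using hne), h0]
    rfl
  refine ⟨𝓕⁻ G, ?_⟩
  refine eq_of_fourier_apply_eq fun ξ => ?_
  rw [fourier_kgOp, fourier_fourierInv_eq, hG]

/-- A solution kills the range of the Klein-Gordon operator, which contains the kernel of
`tameRestriction`; so it factors through `tameRestriction`. -/
lemma IsLCKGSolution.apply_eq {d : ℕ} {m : ℝ} (hm : 0 < m) {u : 𝓢'(Euc (d + 2), ℂ)}
    (hu : IsLCKGSolution m u) {φ ψ : 𝓢(Euc (d + 2), ℂ)}
    (h : tameRestriction hm φ = tameRestriction hm ψ) : u φ = u ψ := by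
  obtain ⟨χ, hχ⟩ := exists_kgOp_eq hm (φ := φ - ψ) (by rw [map_sub, h, sub_self])
  rw [← sub_eq_zero, ← map_sub, ← hχ]
  exact isLCKGSolution_iff.1 hu χ

lemma isLCKGSolution_precomp_tameRestriction {d : ℕ} {m : ℝ} (hm : 0 < m)
    (u₀ : TameDistribution d) :
    IsLCKGSolution m (PointwiseConvergenceCLM.precomp ℂ (tameRestriction hm) u₀) :=
  isLCKGSolution_iff.2 fun φ => by
    change u₀ (tameRestriction hm (kgOp m φ)) = 0
    rw [tameRestriction_kgOp, map_zero]

/-! ### Existence of the tame restriction -/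

lemma exists_pos_support_subset_Ioc {f : 𝓢(ℝ, ℂ)} (hf : HasCompactSupport f) :
    ∃ R : ℝ, Function.support f ⊆ Set.Ioc (-R) R := by
  obtain ⟨R, hR⟩ := hf.isCompact.isBounded.subset_ball (0 : ℝ)
  refine ⟨R, fun x hx => ?_⟩
  have h := abs_lt.1 (by simpa using hR (subset_tsupport _ hx))
  exact ⟨h.1, h.2.le⟩

/-- At a shell point over η both Fourier transforms are 𝓕f(ξ⁺) · 𝓕g(η): averaging translates along
x⁺ contributes the first factor, and the extension restricts to the second. -/
lemma tameRestriction_tensor {d : ℕ} {m : ℝ} (hm : 0 < m) (f : 𝓢(ℝ, ℂ)) {R : ℝ}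
    (hR : Function.support f ⊆ Set.Ioc (-R) R) (g : tameSchwartz d) :
    tameRestriction hm (tensor f (g : 𝓢(Euc (d + 1), ℂ))) =
      tameRestriction hm (translationIntegral f f.continuous (-R) R (e 0)
        (tameExtension hm g)) := by
  refine tameRestriction_eq_of_fourier_eq hm fun η hη => ?_
  rw [fourier_tensor, fourier_translationIntegral, spatial_shellPoint,
    ← shellRestriction_of_ne hm _ hη, shellRestriction_fourier_tameExtension]
  congr 1
  rw [intervalIntegral.integral_eq_integral_of_support_subset
    ((Function.support_mul_subset_right _ _).trans hR), SchwartzMap.fourier_coe, Real.fourier_eq']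
  refine integral_congr_ae (Filter.Eventually.of_forall fun t => ?_)
  simp [EuclideanSpace.inner_single_left, mul_comm]

/-- A solution of the Klein-Gordon equation has a tame restriction. -/
theorem isTameRestriction_precomp_tameExtension {d : ℕ} {m : ℝ} (hm : 0 < m)
    {u : 𝓢'(Euc (d + 2), ℂ)} (hu : IsLCKGSolution m u) :
    IsTameRestriction u (PointwiseConvergenceCLM.precomp ℂ (tameExtension hm) u) := by
  have hsmooth : ∀ φ : 𝓢(Euc (d + 2), ℂ), ContDiff ℝ ∞ fun s : ℝ =>
      u (SchwartzMap.compSubConstCLM ℂ (s • (e 0 : Euc (d + 2))) φ) := fun φ =>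
    contDiff_apply_translate (e 0) φ u
  -- The family is global in x⁺: w_s pairs u with the extension of g translated by s along x⁺.
  refine ⟨Set.univ, isOpen_univ, Set.mem_univ _, fun s => PointwiseConvergenceCLM.precomp ℂ
    ((SchwartzMap.compSubConstCLM ℂ (s • (e 0 : Euc (d + 2)))).comp (tameExtension hm)) u,
    ⟨fun f hf _ g => ?_, fun g => (hsmooth (tameExtension hm g)).contDiffOn⟩, ?_⟩
  · obtain ⟨R, hR⟩ := exists_pos_support_subset_Ioc hf
    rw [relaxation_apply]
    change u (tensor f (g : 𝓢(Euc (d + 1), ℂ))) = ∫ s in Set.univ, u (SchwartzMap.compSubConstCLM ℂ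
      (s • (e 0 : Euc (d + 2))) (tameExtension hm g)) * f s
    rw [hu.apply_eq hm (tameRestriction_tensor hm f hR g), setIntegral_univ]
    refine (integral_apply_translate (f.smooth 1) (e 0) (-R) R _ u
      (hsmooth _).continuous).symm.trans ?_
    rw [intervalIntegral.integral_eq_integral_of_support_subset
      ((Function.support_mul_subset_left _ _).trans hR)]
    exact integral_congr_ae (Filter.Eventually.of_forall fun t => mul_comm _ _)
  · ext g
    change u (SchwartzMap.compSubConstCLM ℂ ((0 : ℝ) • (e 0 : Euc (d + 2)))
      (tameExtension hm g)) = u (tameExtension hm g)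
    rw [zero_smul, SchwartzMap.compSubConstCLM_zero]
    rfl

/-! ### Uniqueness of the tame restriction -/

/-- A generalized function has at most one tame restriction. -/
theorem IsTameRestriction.unique {d : ℕ} {u : 𝓢'(Euc (d + 2), ℂ)} {u₀ u₁ : TameDistribution d}
    (h₀ : IsTameRestriction u u₀) (h₁ : IsTameRestriction u u₁) : u₀ = u₁ := by
  obtain ⟨Ω, hΩ, h0Ω, w, hw, rfl⟩ := h₀
  obtain ⟨Ω', hΩ', h0Ω', w', hw', rfl⟩ := h₁
  ext g
  have hc : ContinuousOn (fun s => w s g) (Ω ∩ Ω') :=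
    (hw.smooth g).continuousOn.mono Set.inter_subset_left
  have hc' : ContinuousOn (fun s => w' s g) (Ω ∩ Ω') :=
    (hw'.smooth g).continuousOn.mono Set.inter_subset_right
  have hU : IsOpen (Ω ∩ Ω') := hΩ.inter hΩ'
  -- Fundamental lemma of the calculus of variations. Its test functions are real, hence the passage
  -- to complex-valued f; both integrals are first cut down to the support of χ, which lies in both
  -- domains.
  have hae : ∀ᵐ s, s ∈ Ω ∩ Ω' → w s g - w' s g = 0 := by
    refine hU.ae_eq_zero_of_integral_contDiff_smul_eq_zero
      ((hc.sub hc').locallyIntegrableOn hU.measurableSet) fun χ hχ hχc hχΩ => ?_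
    have hcs : HasCompactSupport (Complex.ofRealCLM ∘ χ) := hχc.comp_left rfl
    let f : 𝓢(ℝ, ℂ) := hcs.toSchwartzMap (Complex.ofRealCLM.contDiff.comp hχ)
    have hf : ∀ s, f s = (χ s : ℂ) := fun s => rfl
    have hsub : tsupport f ⊆ tsupport χ := closure_mono fun s hs h0 =>
      hs (by rw [hf, h0, Complex.ofReal_zero])
    have hK : tsupport χ ⊆ Ω ∩ Ω' := hχΩ
    have hmeas : MeasurableSet (tsupport χ) := (isClosed_tsupport χ).measurableSet
    have hzero : ∀ s, s ∉ tsupport χ → f s = 0 := fun s hs => by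
      rw [hf, image_eq_zero_of_notMem_tsupport hs, Complex.ofReal_zero]
    have key : ∀ (O : Set ℝ) (v : ℝ → ℂ), IsOpen O → tsupport χ ⊆ O →
        ∫ s in O, v s * f s = ∫ s in tsupport χ, v s * f s := fun O v hO hχO =>
      setIntegral_eq_of_subset_of_forall_sdiff_eq_zero hO.measurableSet hχO fun s hs => by
        rw [hzero s hs.2, mul_zero]
    have hi : ∀ v : ℝ → ℂ, ContinuousOn v (Ω ∩ Ω') →
        IntegrableOn (fun s => v s * f s) (tsupport χ) := fun v hv =>
      ((hv.mono hK).mul f.continuous.continuousOn).integrableOn_compact hχc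
    have h1 := hw.eq_integral f hcs (hsub.trans (hK.trans Set.inter_subset_left)) g
    rw [hw'.eq_integral f hcs (hsub.trans (hK.trans Set.inter_subset_right)) g,
      key _ _ hΩ' (hK.trans Set.inter_subset_right),
      key _ _ hΩ (hK.trans Set.inter_subset_left)] at h1
    have h2 : ∫ s, χ s • (w s g - w' s g) = ∫ s in tsupport χ, (w s g * f s - w' s g * f s) := by
      rw [← setIntegral_univ, setIntegral_eq_of_subset_of_forall_sdiff_eq_zero MeasurableSet.univ
        (Set.subset_univ (tsupport χ)) fun s hs => by
          rw [image_eq_zero_of_notMem_tsupport hs.2, zero_smul]]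
      refine integral_congr_ae (Filter.Eventually.of_forall fun s => ?_)
      simp only [hf, Complex.real_smul]
      ring
    rw [h2, integral_sub (hi _ hc) (hi _ hc'), h1, sub_self]
  -- Continuity upgrades almost everywhere equality to equality at s = 0.
  refine Measure.eqOn_open_of_ae_eq (μ := volume) ?_ hU hc hc' ⟨h0Ω, h0Ω'⟩
  rw [Filter.EventuallyEq, ae_restrict_iff' hU.measurableSet]
  filter_upwards [hae] with s hs h using sub_eq_zero.1 (hs h)

/-- The tame restriction must be u ∘ `tameExtension`, and extending `tameRestriction hm φ` does not
change its image under `tameRestriction`. Both uniqueness claims for solutions follow. -/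
lemma IsLCKGSolution.apply_eq_of_isTameRestriction {d : ℕ} {m : ℝ} (hm : 0 < m)
    {u : 𝓢'(Euc (d + 2), ℂ)} (hu : IsLCKGSolution m u) {u₀ : TameDistribution d}
    (h : IsTameRestriction u u₀) (φ : 𝓢(Euc (d + 2), ℂ)) : u φ = u₀ (tameRestriction hm φ) := by
  rw [h.unique (isTameRestriction_precomp_tameExtension hm hu)]
  exact hu.apply_eq hm (tameRestriction_tameExtension hm _).symm

end LightCone

end

/-! ### The Cauchy problem on the characteristic hyperplane -/

open LightCone
theorem mainTheorem1 (d : ℕ) (m : ℝ) (hm : 0 < m) :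
    (∀ u : 𝓢'(Euc (d + 2), ℂ), IsLCKGSolution m u →
      ∃! u₀ : TameDistribution d, IsTameRestriction u u₀) ∧
    (∀ u : 𝓢'(Euc (d + 2), ℂ), IsLCKGSolution m u → IsTameRestriction u 0 → u = 0) ∧
    (∀ u₀ : TameDistribution d, ∃! u : 𝓢'(Euc (d + 2), ℂ),
      IsLCKGSolution m u ∧ IsTameRestriction u u₀) := by
  refine ⟨fun u hu => ⟨_, isTameRestriction_precomp_tameExtension hm hu, fun v hv =>
    hv.unique (isTameRestriction_precomp_tameExtension hm hu)⟩, fun u hu h0 => ?_, fun u₀ => ?_⟩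
  · ext φ
    exact hu.apply_eq_of_isTameRestriction hm h0 φ
  · have hsol := isLCKGSolution_precomp_tameRestriction hm u₀
    refine ⟨PointwiseConvergenceCLM.precomp ℂ (tameRestriction hm) u₀, ⟨hsol, ?_⟩,
      fun v hv => ?_⟩
    · convert isTameRestriction_precomp_tameExtension hm hsol using 1
      ext g
      exact congrArg u₀ (tameRestriction_tameExtension hm g).symm
    · ext φ
      exact hv.1.apply_eq_of_isTameRestriction hm hv.2 φ
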